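/- **Setting.** Let $P_1=(0,0)$, $P_2=(1,0)$, $P_3=(\tfrac12,\tfrac{\sqrt3}{2})$ in $\mathbb R^2$. For points $A_1,A_2,A_3$ let $\Delta(A_1,A_2,A_3)$ be the closed filled triangle they span (the order of the vertices is part of the datum), and let $P_{\Delta(A_1,A_2,A_3)}$ be the map $\alpha_1P_1+\alpha_2P_2+\alpha_3P_3\mapsto\alpha_1A_1+\alpha_2A_2+\alpha_3A_3$ ($\alpha_1+\alpha_2+\alpha_3=1$), applied to triangles vertex by vertex. Let $m\ge 2$ be an integer. For $k\in\mathbb N^3$ ($0\in\mathbb N$) let $T_m(k)$ be the triangle with vertices $A_i=\frac1m\bigl(P_i+\sum_j k_jP_j\bigr)$ and $T'_m(k)$ the triangle with vertices $A_i=\frac1m\bigl(\sum_{j\ne i}P_j+\sum_j k_jP_j\bigr)$, $i=1,2,3$. Put $$\mathcal T_m=\{T_m(k): k_1+k_2+k_3=m-1\},\qquad \mathcal T'_m=\{T'_m(k): k_1+k_2+k_3=m-2\}.$$ Triangles $T_m(k)\in\mathcal T_m$ and $T'_m(k')\in\mathcal T'_m$ are *adjacent* if for some $j$ we have $k_j=k'_j+1$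 and $k_i=k'_i$ for all $i\ne j$ (that is, if they share a side). Let $\mathcal W,\mathcal Y\subseteq\mathcal T_m$ and $\mathcal W',\mathcal Y'\subseteq\mathcal T'_m$. The pair $(\mathcal W\cup\mathcal W',\mathcal Y\cup\mathcal Y')$ is an *$m$-triangular labyrinth patterns system* if 1. (tree property) the graphs with vertex sets $\mathcal W\cup\mathcal W'$ and $\mathcal Y\cup\mathcal Y'$ and the above adjacency are both trees; 2. (exits property) there is exactly one triple $(k_1,k_2,k_3)$ of integers in $\{0,\dots,m-1\}$ such that $T_m(0,k_1,m-1-k_1)\in\mathcal W$ and $T_m(0,m-1-k_1,k_1)\in\mathcal Y$, $T_m(k_2,0,m-1-k_2)\in\mathcal W$ and $T_m(m-1-k_2,0,k_2)\in\mathcal Y$, $T_m(k_3,m-1-k_3,0)\in\mathcal W$ and $T_m(m-1-k_3,k_3,0)\in\mathcal Y$; 3. (corners property) $\mathcal W$ and $\mathcal Y$ each have at most one element that contains one of the points $P_1,P_2,P_3$, and they have no such element in common. Given such a system, let $\mathcal W_1=\mathcal W$, $\mathcal W'_1=\mathcal W'$, $\mathcal Y_1=\mathcal Y$, $\mathcal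 Y'_1=\mathcal Y'$ and, for $n\ge 2$, $$\mathcal W_n=\{P_A(B): A\in\mathcal W_{n-1},B\in\mathcal W\}\cup\{P_A(B): A\in\mathcal W'_{n-1},B\in\mathcal Y'\},$$ $$\mathcal W'_n=\{P_A(B): A\in\mathcal W_{n-1},B\in\mathcal W'\}\cup\{P_A(B): A\in\mathcal W'_{n-1},B\in\mathcal Y\},$$ $$\mathcal Y_n=\{P_A(B): A\in\mathcal Y_{n-1},B\in\mathcal Y\}\cup\{P_A(B): A\in\mathcal Y'_{n-1},B\in\mathcal W'\},$$ $$\mathcal Y'_n=\{P_A(B): A\in\mathcal Y_{n-1},B\in\mathcal Y'\}\cup\{P_A(B): A\in\mathcal Y'_{n-1},B\in\mathcal W\}.$$ The white and the yellow triangular labyrinth fractal generated by the system are $$L^{\mathrm{white}}_\infty=\bigcap_{n\ge1}\ \bigcup_{A\in\mathcal W_n\cup\mathcal W'_n}A,\qquad L^{\mathrm{yellow}}_\infty=\bigcap_{n\ge1}\ \bigcup_{A\in\mathcal Y_n\cup\mathcal Y'_n}A .$$ **Theorem.** For every $m\ge2$ and every $m$-triangular labyrinth patterns system, $L^{\mathrm{white}}_\infty$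 and $L^{\mathrm{yellow}}_\infty$ are dendrites: each of them is a non-empty, compact, connected and locally connected set that contains no simple closed curve (no subset homeomorphic to the circle). -/

import Mathlib

noncomputable section

namespace TriLabyrinth

abbrev Plane := EuclideanSpace ℝ (Fin 2)

/-- A triangle, recorded by its ordered triple of vertices `(A₁, A₂, A₃)`
(the index set is `Fin 3`, so the indices `1, 2, 3` become `0, 1, 2`). -/
abbrev Triangle := Fin 3 → Plane

/-- The full (closed, filled) triangle `Δ(A₁, A₂, A₃)` as a subset of the plane. -/
def Triangle.full (A : Triangle) : Set Plane := convexHull ℝ (Set.range A)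

/-- The vertices `P₁ = (0, 0)`, `P₂ = (1, 0)`, `P₃ = (1/2, √3/2)` of the unit triangle `T₁`. -/
def P : Triangle := ![!₂[0, 0], !₂[1, 0], !₂[1 / 2, √3 / 2]]

/-- Homogeneous coordinates of a point of the plane with respect to `P₁, P₂, P₃`;
see `sum_coord`, `sum_coord_smul` and `coord_sum_smul`. -/
def coord (x : Plane) : Fin 3 → ℝ :=
  ![1 - x 0 - x 1 / √3, x 0 - x 1 / √3, 2 * x 1 / √3]

theorem sum_coord (x : Plane) : ∑ i, coord x i = 1 := by
  simp only [coord, Fin.sum_univ_three, Matrix.cons_val]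
  ring

theorem sum_coord_smul (x : Plane) : ∑ i, coord x i • P i = x := by
  have h : √3 ≠ 0 := by positivity
  ext i
  fin_cases i
  · simp [coord, P, Fin.sum_univ_three]
    field_simp
    ring
  · simp [coord, P, Fin.sum_univ_three]
    field_simp

theorem coord_sum_smul (α : Fin 3 → ℝ) (hα : ∑ i, α i = 1) :
    coord (∑ i, α i • P i) = α := by
  have h : √3 ≠ 0 := by positivity
  have h0 : α 0 = 1 - α 1 - α 2 := by
    rw [Fin.sum_univ_three] at hα
    linarith
  ext i
  fin_cases i
  · simp [coord, P, Fin.sum_univ_three, h0]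
    field_simp
    ring
  · simp [coord, P, Fin.sum_univ_three]
    field_simp
    ring
  · simp [coord, P, Fin.sum_univ_three]
    field_simp

/-- The projection map `P_Δ`, `Δ = Δ(A₁, A₂, A₃)`, which sends the point with homogeneous
coordinates `α` to `α₁ A₁ + α₂ A₂ + α₃ A₃`. -/
def Triangle.proj (A : Triangle) (x : Plane) : Plane := ∑ i, coord x i • A i

/-- The triangle `P_A(B)`, with vertices the images of the vertices of `B`. -/
def Triangle.projTriangle (A B : Triangle) : Triangle := fun i => A.proj (B i)

/-- The upright triangle `T_m(k₁, k₂, k₃)`: its `i`-th vertex is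
`(k₁ P₁ + k₂ P₂ + k₃ P₃ + P_i) / m`. -/
def up (m : ℕ) (k : Fin 3 → ℕ) : Triangle :=
  fun i => (1 / (m : ℝ)) • ∑ j, ((k j : ℝ) + if j = i then 1 else 0) • P j

/-- The upside down triangle `T'_m(k₁, k₂, k₃)`: its `i`-th vertex is
`(k₁ P₁ + k₂ P₂ + k₃ P₃ + ∑_{j ≠ i} P_j) / m`. -/
def down (m : ℕ) (k : Fin 3 → ℕ) : Triangle :=
  fun i => (1 / (m : ℝ)) • ∑ j, ((k j : ℝ) + if j = i then 0 else 1) • P j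

/-- The set `𝒯_m` of upright triangles, indices with `k₁ + k₂ + k₃ = m - 1`. -/
def upTriangles (m : ℕ) : Set Triangle := {A | ∃ k : Fin 3 → ℕ, ∑ i, k i + 1 = m ∧ A = up m k}

/-- The set `𝒯'_m` of upside down triangles, indices with `k₁ + k₂ + k₃ = m - 2`. -/
def downTriangles (m : ℕ) : Set Triangle :=
  {A | ∃ k : Fin 3 → ℕ, ∑ i, k i + 2 = m ∧ A = down m k}

/-- `A = T_m(k) ∈ 𝒯_m` and `B = T'_m(k') ∈ 𝒯'_m` are `j`-neighbours: `k_j = k'_j + 1` and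
`k_i = k'_i` for `i ≠ j`. Equivalently they share the side of type `j`. -/
def Neighbours (m : ℕ) (j : Fin 3) (A B : Triangle) : Prop :=
  ∃ k k' : Fin 3 → ℕ, (∑ i, k i + 1 = m ∧ A = up m k) ∧ (∑ i, k' i + 2 = m ∧ B = down m k') ∧
    k j = k' j + 1 ∧ ∀ i, i ≠ j → k i = k' i

/-- The graph whose vertices are the triangles of the set `V`, two of them being adjacent if and
only if they are `j`-neighbours for some `j`. -/
def triangleGraph (m : ℕ) (V : Set Triangle) : SimpleGraph V :=
  SimpleGraph.fromRel fun A B : V => ∃ j, Neighbours m j A B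

/-- An `m`-triangular patterns system `(𝒲 ∪ 𝒲', 𝒴 ∪ 𝒴')`. -/
structure PatternsSystem (m : ℕ) where
  W : Set Triangle
  W' : Set Triangle
  Y : Set Triangle
  Y' : Set Triangle
  W_subset : W ⊆ upTriangles m
  W'_subset : W' ⊆ downTriangles m
  Y_subset : Y ⊆ upTriangles m
  Y'_subset : Y' ⊆ downTriangles m

/-- The corner triangles in a set of triangles: those that contain `P₁`, `P₂` or `P₃`. -/
def corners (V : Set Triangle) : Set Triangle := {A ∈ V | (A.full ∩ Set.range P).Nonempty}

namespace PatternsSystem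

variable {m : ℕ}

/-- The two trees, one for each colour. -/
def TreeProperty (S : PatternsSystem m) : Prop :=
  (triangleGraph m (S.W ∪ S.W')).IsTree ∧ (triangleGraph m (S.Y ∪ S.Y')).IsTree

/-- There is exactly one triple `(k₁, k₂, k₃)` of indices of matching exits. -/
def ExitsProperty (S : PatternsSystem m) : Prop :=
  ∃! k : Fin 3 → ℕ, (∀ i, k i < m) ∧
    (up m ![0, k 0, m - 1 - k 0] ∈ S.W ∧ up m ![0, m - 1 - k 0, k 0] ∈ S.Y) ∧
    (up m ![k 1, 0, m - 1 - k 1] ∈ S.W ∧ up m ![m - 1 - k 1, 0, k 1] ∈ S.Y) ∧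
    (up m ![k 2, m - 1 - k 2, 0] ∈ S.W ∧ up m ![m - 1 - k 2, k 2, 0] ∈ S.Y)

/-- Each pattern has at most one corner triangle, and they have none in common. -/
def CornersProperty (S : PatternsSystem m) : Prop :=
  corners S.W ∩ corners S.Y = ∅ ∧ (corners S.W).encard ≤ 1 ∧ (corners S.Y).encard ≤ 1

/-- An `m`-triangular labyrinth patterns system. -/
structure IsLabyrinth (S : PatternsSystem m) : Prop where
  tree : S.TreeProperty
  exits : S.ExitsProperty
  corners : S.CornersProperty

/-- `S.white n` is the pair `(𝒲_{n+1}, 𝒲'_{n+1})` of the sets of upright and of upside down white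
triangles of level `n + 1`. -/
def white (S : PatternsSystem m) : ℕ → Set Triangle × Set Triangle
  | 0 => (S.W, S.W')
  | n + 1 =>
    (Set.image2 Triangle.projTriangle (S.white n).1 S.W ∪
        Set.image2 Triangle.projTriangle (S.white n).2 S.Y',
      Set.image2 Triangle.projTriangle (S.white n).1 S.W' ∪
        Set.image2 Triangle.projTriangle (S.white n).2 S.Y)

/-- `S.yellow n` is the pair `(𝒴_{n+1}, 𝒴'_{n+1})` of the sets of upright and of upside down yellow
triangles of level `n + 1`. -/
def yellow (S : PatternsSystem m) : ℕ → Set Triangle × Set Triangle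
  | 0 => (S.Y, S.Y')
  | n + 1 =>
    (Set.image2 Triangle.projTriangle (S.yellow n).1 S.Y ∪
        Set.image2 Triangle.projTriangle (S.yellow n).2 S.W',
      Set.image2 Triangle.projTriangle (S.yellow n).1 S.Y' ∪
        Set.image2 Triangle.projTriangle (S.yellow n).2 S.W)

/-- The white fractal: the intersection over all levels `n + 1 ≥ 1` of the union of the white
triangles of that level. -/
def whiteFractal (S : PatternsSystem m) : Set Plane :=
  ⋂ n : ℕ, ((⋃ A ∈ (S.white n).1, Triangle.full A) ∪ ⋃ A ∈ (S.white n).2, Triangle.full A)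

/-- The yellow fractal. -/
def yellowFractal (S : PatternsSystem m) : Set Plane :=
  ⋂ n : ℕ, ((⋃ A ∈ (S.yellow n).1, Triangle.full A) ∪ ⋃ A ∈ (S.yellow n).2, Triangle.full A)

end PatternsSystem

/-- A simple closed curve: a homeomorphic image of the circle. -/
def IsSimpleClosedCurve {X : Type*} [TopologicalSpace X] (C : Set X) : Prop :=
  Nonempty (Circle ≃ₜ C)

/-- A dendrite (in the plane): a locally connected continuum containing no simple closed curve. -/
structure IsDendrite (D : Set Plane) : Prop where
  isCompact : IsCompact D
  isConnected : IsConnected D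
  locallyConnected : LocallyConnectedSpace D
  noSimpleClosedCurve : ∀ C ⊆ D, ¬ IsSimpleClosedCurve C

end TriLabyrinth

end

/-! ### Cutting a tree at an edge -/

open Set Topology

/-! Each fractal splits along its pattern into copies of ratio `1 / m`: an upright cell carries a
translated copy of the fractal of the same colour, an upside down cell a point-reflected copy of the
fractal of the other colour. The two fractals are thus the attractors of a graph directed system
with two states.

The heart of the matter is that two pieces meet exactly when their cells are adjacent, and then in
one point. Two cells of the same orientation touch at most in a vertex, and a common point of their
pieces would put two different corners `P i` into one fractal. Cells of opposite orientation that
share only a vertex would put the same corner into both fractals. The corners property excludes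
both. Across a common side, common points correspond to pairs of points, one in each fractal,
symmetric about the midpoint of a side of the large triangle (`MirrorPoints`). The fixed points of
the two matching exit cells form such a pair (`exists_mirrorPoints`). Conversely, every pair comes
from a pair inside matching exits (`mirrorPoints_cases`); these are unique, so by contraction the
pair is unique (`mirrorPoints_unique`).

The rest is formal (`TreeLikeSystem`). Connectedness of the tree propagates to the attractor, the
small pieces give local connectedness, and a circle, having no cut point, must lie in a single piece
at every level, hence has diameter zero. -/

/-- The first edge of the path from `v` to `w` is a bridge, and the rest of the path avoids `v`,
hence avoids that edge. -/
theorem SimpleGraph.IsTree.exists_adj_not_reachable {V : Type*} {G : SimpleGraph V}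
    (hG : G.IsTree) {v w : V} (h : v ≠ w) :
    ∃ u, G.Adj v u ∧ ¬(G.deleteEdges {s(v, u)}).Reachable v w := by
  obtain ⟨p, hp⟩ := (hG.connected.preconnected v w).exists_isPath
  cases p with
  | nil => exact absurd rfl h
  | @cons _ u _ hadj q =>
    refine ⟨u, hadj, fun hr => ?_⟩
    rw [SimpleGraph.Walk.cons_isPath_iff] at hp
    have hbr := SimpleGraph.isAcyclic_iff_forall_adj_isBridge.1 hG.isAcyclic hadj
    rw [SimpleGraph.isBridge_iff] at hbr
    have hq : s(v, u) ∉ q.edges := fun he => hp.2 (q.fst_mem_support_of_mem_edges he)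
    exact hbr (hr.trans (q.toDeleteEdge s(v, u) hq).reachable.symm)

/-- In a tree, the component of `v` after deletion of the edge `v u` is only connected to its
complement by that edge. -/
theorem SimpleGraph.IsTree.eq_of_adj_of_not_reachable {V : Type*} {G : SimpleGraph V}
    (hG : G.IsTree) {v u a b : V} (hvu : G.Adj v u)
    (ha : (G.deleteEdges {s(v, u)}).Reachable v a)
    (hb : ¬(G.deleteEdges {s(v, u)}).Reachable v b) (hab : G.Adj a b) : a = v ∧ b = u := by
  have hbr := SimpleGraph.isAcyclic_iff_forall_adj_isBridge.1 hG.isAcyclic hvu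
  rw [SimpleGraph.isBridge_iff] at hbr
  by_cases he : s(a, b) = s(v, u)
  · rcases Sym2.eq_iff.1 he with h | h
    · exact h
    · rw [h.1] at ha
      exact absurd ha hbr
  · refine absurd (ha.trans (SimpleGraph.Adj.reachable ?_)) hb
    simpa [SimpleGraph.deleteEdges_adj, hab] using he

theorem SimpleGraph.Connected.forall_of_adj {V : Type*} {G : SimpleGraph V} (hG : G.Connected)
    {p : V → Prop} (hp : ∀ v w, G.Adj v w → p v → p w) {v : V} (hv : p v) (w : V) : p w := by
  obtain ⟨q⟩ := hG.preconnected v w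
  induction q with
  | nil => exact hv
  | cons h _ ih => exact ih (hp _ _ h hv)

/-! ### Two topological criteria, and the circle -/

/-- A set that admits finite covers by closed connected subsets of arbitrarily small
diameter is locally connected. -/
theorem locallyConnectedSpace_of_covers {X : Type*} [MetricSpace X] {L : Set X}
    (h : ∀ ε > 0, ∃ F : Set (Set X), F.Finite ∧ ⋃₀ F = L ∧
      ∀ s ∈ F, IsClosed s ∧ IsPreconnected s ∧ ∀ x ∈ s, ∀ y ∈ s, dist x y < ε) :
    LocallyConnectedSpace L := by
  rw [locallyConnectedSpace_iff_connected_subsets]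
  intro x U hU
  obtain ⟨ε, hε, hεU⟩ := Metric.mem_nhds_iff.1 hU
  obtain ⟨F, hF, hFL, hFs⟩ := h ε hε
  -- `V'` is closed because `F` is finite, and it misses `x`; so `V`, which contains `L \ V'`, is a
  -- neighbourhood of `x` in `L`. It is connected because all its members contain `x`.
  let V : Set X := ⋃₀ {s ∈ F | x.1 ∈ s}
  let V' : Set X := ⋃₀ {s ∈ F | x.1 ∉ s}
  have hVL : V ⊆ L := hFL ▸ sUnion_subset_sUnion (sep_subset _ _)
  have hV' : IsClosed V' :=
    by
    simp only [V', sUnion_eq_biUnion]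
    exact (hF.subset (sep_subset _ _)).isClosed_biUnion fun s hs => (hFs s hs.1).1
  have hx' : x.1 ∉ V' := by
    rintro ⟨s, hs, hxs⟩
    exact hs.2 hxs
  refine ⟨Subtype.val ⁻¹' V, ?_, ?_, ?_⟩
  · refine Filter.mem_of_superset
      ((hV'.isOpen_compl.preimage continuous_subtype_val).mem_nhds hx') fun y hy => ?_
    obtain ⟨s, hs, hys⟩ : y.1 ∈ ⋃₀ F := hFL ▸ y.2
    by_cases hxs : x.1 ∈ s
    · exact ⟨s, ⟨hs, hxs⟩, hys⟩
    · exact absurd ⟨s, ⟨hs, hxs⟩, hys⟩ hy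
  · rw [← IsInducing.subtypeVal.isPreconnected_image, Subtype.image_preimage_coe,
      inter_eq_self_of_subset_right hVL]
    exact isPreconnected_sUnion x.1 _ (fun s hs => hs.2) fun s hs => (hFs s hs.1).2.1
  · rintro y ⟨s, hs, hys⟩
    exact hεU ((hFs s hs.1).2.2 _ hys _ hs.2)

/-- A finite union of closed sets arranged along a tree, two of them meeting if and only if they
are adjacent and then in a single point: an infinite set without cut points lies in one of them. -/
theorem SimpleGraph.IsTree.subset_of_forall_isPreconnected_diff {V X : Type*} [Finite V]
    [TopologicalSpace X] {G : SimpleGraph V} (hG : G.IsTree) {K : V → Set X}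
    (hK : ∀ v, IsClosed (K v)) (hadj : ∀ v w, G.Adj v w → (K v ∩ K w).Nonempty)
    (hmeet : ∀ v w, v ≠ w → (K v ∩ K w).Nonempty → G.Adj v w)
    (hsub : ∀ v w, v ≠ w → (K v ∩ K w).Subsingleton)
    {C : Set X} (hCK : C ⊆ ⋃ v, K v) (hinf : C.Infinite)
    (hC : ∀ x, IsPreconnected (C \ {x})) : ∃ v, C ⊆ K v := by
  have hfin : (⋃ (v) (w) (_ : v ≠ w), K v ∩ K w).Finite :=
    finite_iUnion fun v => finite_iUnion fun w => finite_iUnion fun h => (hsub v w h).finite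
  -- As only finitely many points lie in two pieces, some point of `C` lies in exactly one, `K v`.
  obtain ⟨x, hxC, hx⟩ := (hinf.sdiff hfin).nonempty
  obtain ⟨v, hxv⟩ := mem_iUnion.1 (hCK hxC)
  have hxv' : ∀ w, x ∈ K w → w = v := by
    intro w hw
    by_contra h
    exact hx (mem_iUnion.2 ⟨w, mem_iUnion.2 ⟨v, mem_iUnion.2 ⟨h, hw, hxv⟩⟩⟩)
  refine ⟨v, fun y hy => ?_⟩
  obtain ⟨w, hyw⟩ := mem_iUnion.1 (hCK hy)
  by_cases hvw : v = w
  · rwa [hvw]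
  obtain ⟨u, hvu, hr⟩ := hG.exists_adj_not_reachable hvw
  -- The first edge `v u` towards `w` cuts the tree into two sides with unions `A` and `B`, which
  -- share only the point `p` of `K v ∩ K u`. If `y` were outside `K v`, then `A` and `B` would
  -- separate `x` from `y` in `C \ {p}`.
  let R : V → Prop := (G.deleteEdges {s(v, u)}).Reachable v
  let A : Set X := ⋃ a ∈ {a | R a}, K a
  let B : Set X := ⋃ a ∈ {a | ¬R a}, K a
  have hA : IsClosed A := (toFinite _).isClosed_biUnion fun a _ => hK a
  have hB : IsClosed B := (toFinite _).isClosed_biUnion fun a _ => hK a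
  have hRv : R v := SimpleGraph.Reachable.refl _
  have hAB : A ∩ B ⊆ K v ∩ K u := by
    rintro z ⟨hzA, hzB⟩
    obtain ⟨a, ha, hza⟩ := mem_iUnion₂.1 hzA
    obtain ⟨b, hb, hzb⟩ := mem_iUnion₂.1 hzB
    have hab : a ≠ b := fun h => hb (h ▸ ha)
    obtain ⟨rfl, rfl⟩ := hG.eq_of_adj_of_not_reachable hvu ha hb (hmeet a b hab ⟨z, hza, hzb⟩)
    exact ⟨hza, hzb⟩
  have hcov : C ⊆ A ∪ B := by
    intro z hz
    obtain ⟨a, ha⟩ := mem_iUnion.1 (hCK hz)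
    by_cases h : R a
    · exact Or.inl (mem_biUnion h ha)
    · exact Or.inr (mem_biUnion h ha)
  obtain ⟨p, hpv, hpu⟩ := hadj v u hvu
  have hp : ∀ z ∈ K v ∩ K u, z = p := fun z hz => hsub v u hvu.ne hz ⟨hpv, hpu⟩
  by_cases hyv : y ∈ K v
  · exact hyv
  have hxp : x ≠ p := by
    rintro rfl
    exact hvu.ne (hxv' u hpu).symm
  have hyp : y ≠ p := by
    rintro rfl
    exact hyv hpv
  obtain ⟨z, hz, hzAB⟩ := isPreconnected_closed_iff.1 (hC p) A B hA hB
    (fun z hz => hcov hz.1) ⟨x, ⟨hxC, hxp⟩, mem_biUnion hRv hxv⟩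
    ⟨y, ⟨hy, hyp⟩, mem_biUnion (show w ∈ {a | ¬R a} from hr) hyw⟩
  exact absurd (hp z (hAB hzAB)) hz.2

theorem TriLabyrinth.IsSimpleClosedCurve.infinite {X : Type*} [TopologicalSpace X] {C : Set X}
    (hC : TriLabyrinth.IsSimpleClosedCurve C) : C.Infinite := by
  obtain ⟨e⟩ := hC
  have h : Infinite Circle := by
    have := (Ico_infinite Real.two_pi_pos).to_subtype
    exact Infinite.of_injective _
      (injOn_iff_injective.1 (Circle.exp_injOn_Ico (a := 0) (b := 2 * Real.pi) (by simp)))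
  have : Infinite C := e.toEquiv.infinite_iff.1 h
  exact infinite_coe_iff.1 this

theorem TriLabyrinth.IsSimpleClosedCurve.isPreconnected_sdiff_singleton {X : Type*}
    [TopologicalSpace X] {C : Set X} (hC : TriLabyrinth.IsSimpleClosedCurve C) (p : X) :
    IsPreconnected (C \ {p}) := by
  obtain ⟨e⟩ := hC
  by_cases hp : p ∈ C
  · have h := (Circle.isPathConnected_compl_singleton (e.symm ⟨p, hp⟩)).isConnected.isPreconnected
    convert h.image (fun z => (e z : X)) (by fun_prop) using 1
    ext x
    constructor
    · rintro ⟨hx, hxp⟩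
      refine ⟨e.symm ⟨x, hx⟩, fun h => hxp ?_, by simp⟩
      simpa using e.symm.injective h
    · rintro ⟨z, hz, rfl⟩
      refine ⟨(e z).2, fun h => hz ?_⟩
      rw [mem_singleton_iff, Homeomorph.eq_symm_apply]
      exact Subtype.ext h
  · rw [sdiff_singleton_eq_self hp]
    convert (isPreconnected_univ (α := Circle)).image (fun z => (e z : X)) (by fun_prop) using 1
    rw [image_univ, ← Function.comp_def, e.surjective.range_comp, Subtype.range_coe]

/-! ### Attractors of tree-like graph directed systems -/

/-- Compact non-empty attractors `L c` of a graph directed system of similarities `f c i` of ratio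
`r < 1`, where the pieces of each `L c` are arranged along a tree `G c`: two pieces meet if and only
if they are adjacent, and then in a single point. -/
structure TreeLikeSystem {κ X : Type*} [MetricSpace X] {ι : κ → Type*}
    (G : ∀ c, SimpleGraph (ι c)) (f : ∀ c, ι c → X → X) (col : ∀ c, ι c → κ) (L : κ → Set X)
    (r : ℝ) : Prop where
  pos : 0 < r
  lt_one : r < 1
  dist_eq : ∀ c i x y, dist (f c i x) (f c i y) = r * dist x y
  isCompact : ∀ c, IsCompact (L c)
  nonempty : ∀ c, (L c).Nonempty
  eq_iUnion : ∀ c, L c = ⋃ i, f c i '' L (col c i)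
  isTree : ∀ c, (G c).IsTree
  inter_nonempty : ∀ c i j, (G c).Adj i j →
    (f c i '' L (col c i) ∩ f c j '' L (col c j)).Nonempty
  adj : ∀ c i j, i ≠ j → (f c i '' L (col c i) ∩ f c j '' L (col c j)).Nonempty → (G c).Adj i j
  inter_subsingleton : ∀ c i j, i ≠ j →
    (f c i '' L (col c i) ∩ f c j '' L (col c j)).Subsingleton

namespace TreeLikeSystem

variable {κ X : Type*} [MetricSpace X] {ι : κ → Type*}
  {G : ∀ c, SimpleGraph (ι c)} {f : ∀ c, ι c → X → X} {col : ∀ c, ι c → κ} {L : κ → Set X} {r : ℝ}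

theorem isEmbedding (h : TreeLikeSystem G f col L r) (c : κ) (i : ι c) : IsEmbedding (f c i) := by
  have hr : (0 : ℝ) < r⁻¹ := inv_pos.2 h.pos
  have hanti : AntilipschitzWith r⁻¹.toNNReal (f c i) := by
    refine AntilipschitzWith.of_le_mul_dist fun x y => ?_
    rw [h.dist_eq, Real.coe_toNNReal _ hr.le, inv_mul_cancel_left₀ h.pos.ne']
  have hlip : LipschitzWith r.toNNReal (f c i) := by
    refine LipschitzWith.of_dist_le_mul fun x y => ?_
    rw [h.dist_eq, Real.coe_toNNReal _ h.pos.le]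
  exact hanti.isEmbedding hlip.continuous

theorem image_subset (h : TreeLikeSystem G f col L r) (c : κ) (i : ι c) :
    f c i '' L (col c i) ⊆ L c := by
  conv_rhs => rw [h.eq_iUnion c]
  exact subset_iUnion (fun i => f c i '' L (col c i)) i

theorem exists_mem (h : TreeLikeSystem G f col L r) {c : κ} {x : X} (hx : x ∈ L c) :
    ∃ i, x ∈ f c i '' L (col c i) := by
  rw [h.eq_iUnion c] at hx
  exact mem_iUnion.1 hx

theorem exists_dist_le [Finite κ] (h : TreeLikeSystem G f col L r) :
    ∃ D, ∀ c, ∀ x ∈ L c, ∀ y ∈ L c, dist x y ≤ D := by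
  obtain ⟨D, hD⟩ := Metric.isBounded_iff.1 (isCompact_iUnion h.isCompact).isBounded
  exact ⟨D, fun c x hx y hy => hD (mem_iUnion_of_mem c hx) (mem_iUnion_of_mem c hy)⟩

theorem exists_mul_pow_lt (h : TreeLikeSystem G f col L r) (D : ℝ) {ε : ℝ} (hε : 0 < ε) :
    ∃ n : ℕ, D * r ^ n < ε := by
  have ht := (tendsto_pow_atTop_nhds_zero_of_lt_one h.pos.le h.lt_one).const_mul D
  rw [mul_zero] at ht
  exact (ht.eventually (gt_mem_nhds hε)).exists

/-- The two parts of any partition of `L c` come arbitrarily close to each other. -/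
theorem exists_dist_le_mul_pow (h : TreeLikeSystem G f col L r) {D : ℝ}
    (hD : ∀ c, ∀ x ∈ L c, ∀ y ∈ L c, dist x y ≤ D) (n : ℕ) :
    ∀ (c : κ) (p : X → Prop), (∃ x ∈ L c, p x) → (∃ x ∈ L c, ¬p x) →
      ∃ x ∈ L c, ∃ y ∈ L c, p x ∧ ¬p y ∧ dist x y ≤ D * r ^ n := by
  induction n with
  | zero =>
    rintro c p ⟨x, hx, hpx⟩ ⟨y, hy, hpy⟩
    exact ⟨x, hx, y, hy, hpx, hpy, by simpa using hD c x hx y hy⟩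
  | succ n ih =>
    rintro c p ⟨x, hx, hpx⟩ ⟨y, hy, hpy⟩
    -- Either the partition splits some piece, and the induction hypothesis applies inside it, or
    -- every piece lies in one part; then the common points of adjacent pieces spread that part over
    -- the whole tree.
    by_cases hs : ∃ i, (∃ x ∈ L (col c i), p (f c i x)) ∧ ∃ y ∈ L (col c i), ¬p (f c i y)
    · obtain ⟨i, hi, hi'⟩ := hs
      obtain ⟨x, hx, y, hy, hpx, hpy, hxy⟩ := ih (col c i) (fun x => p (f c i x)) hi hi'
      refine ⟨_, h.image_subset c i (mem_image_of_mem _ hx), _,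
        h.image_subset c i (mem_image_of_mem _ hy), hpx, hpy, ?_⟩
      rw [h.dist_eq, pow_succ', mul_left_comm]
      exact mul_le_mul_of_nonneg_left hxy h.pos.le
    · push Not at hs
      obtain ⟨i, x, hxi, rfl⟩ := h.exists_mem hx
      obtain ⟨j, y, hyj, rfl⟩ := h.exists_mem hy
      refine absurd ?_ hpy
      refine (h.isTree c).connected.forall_of_adj (p := fun j => ∀ y ∈ L (col c j), p (f c j y))
        (fun a b hab ha => ?_) (hs i ⟨x, hxi, hpx⟩) j y hyj
      obtain ⟨_, ⟨z, hz, rfl⟩, z', hz', hzz'⟩ := h.inter_nonempty c a b hab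
      exact hs b ⟨z', hz', hzz' ▸ ha z hz⟩

/-- The parts of a closed partition of a compact set have positive distance, against
`exists_dist_le_mul_pow`. -/
theorem isConnected [Finite κ] (h : TreeLikeSystem G f col L r) (c : κ) : IsConnected (L c) := by
  refine ⟨h.nonempty c, isPreconnected_closed_iff.2 fun A B hA hB hAB hLA hLB => ?_⟩
  by_contra hne
  have hdisj : Disjoint (L c ∩ A) (L c ∩ B) := by
    rw [Set.disjoint_left]
    rintro x ⟨hx, hxA⟩ ⟨-, hxB⟩
    exact hne ⟨x, hx, hxA, hxB⟩
  obtain ⟨δ, hδ, hδAB⟩ := hdisj.exists_thickenings ((h.isCompact c).inter_right hA)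
    ((h.isCompact c).isClosed.inter hB)
  obtain ⟨D, hD⟩ := h.exists_dist_le
  obtain ⟨n, hn⟩ := h.exists_mul_pow_lt D hδ
  obtain ⟨b, hb⟩ := hLB
  obtain ⟨x, hx, y, hy, hxA, hyA, hxy⟩ := h.exists_dist_le_mul_pow hD n c (· ∈ A) hLA
    ⟨b, hb.1, fun hbA => hne ⟨b, hb.1, hbA, hb.2⟩⟩
  have hyB : y ∈ B := (hAB hy).resolve_left hyA
  refine Set.disjoint_left.1 hδAB (Metric.mem_thickening_iff.2 ⟨x, ⟨hx, hxA⟩, ?_⟩)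
    (Metric.self_subset_thickening hδ _ ⟨hy, hyB⟩)
  rw [dist_comm]
  exact hxy.trans_lt hn

/-- The covers are the pieces of level `n`, connected as similar images of the attractors. -/
theorem exists_cover [Finite κ] [∀ c, Finite (ι c)] (h : TreeLikeSystem G f col L r) {D : ℝ}
    (hD : ∀ c, ∀ x ∈ L c, ∀ y ∈ L c, dist x y ≤ D) (n : ℕ) :
    ∀ c, ∃ F : Set (Set X), F.Finite ∧ ⋃₀ F = L c ∧
      ∀ s ∈ F, IsCompact s ∧ IsPreconnected s ∧ ∀ x ∈ s, ∀ y ∈ s, dist x y ≤ D * r ^ n := by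
  induction n with
  | zero =>
    refine fun c => ⟨{L c}, finite_singleton _, sUnion_singleton _, ?_⟩
    rintro _ rfl
    exact ⟨h.isCompact c, (h.isConnected c).isPreconnected, by simpa using hD c⟩
  | succ n ih =>
    choose F hF hFL hFs using ih
    refine fun c => ⟨⋃ i, image (f c i) '' F (col c i),
      finite_iUnion fun i => (hF _).image _, ?_, ?_⟩
    · rw [sUnion_iUnion, h.eq_iUnion c]
      refine iUnion_congr fun i => ?_
      rw [← hFL, sUnion_image, sUnion_eq_biUnion, image_iUnion₂]
    · intro s hs
      obtain ⟨i, t, ht, rfl⟩ := mem_iUnion.1 hs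
      obtain ⟨hc, hp, hd⟩ := hFs _ t ht
      have hf := (h.isEmbedding c i).continuous
      refine ⟨hc.image hf, hp.image _ hf.continuousOn, ?_⟩
      rintro _ ⟨x, hx, rfl⟩ _ ⟨y, hy, rfl⟩
      rw [h.dist_eq, pow_succ', mul_left_comm]
      exact mul_le_mul_of_nonneg_left (hd x hx y hy) h.pos.le

theorem locallyConnectedSpace [Finite κ] [∀ c, Finite (ι c)] (h : TreeLikeSystem G f col L r)
    (c : κ) : LocallyConnectedSpace (L c) := by
  obtain ⟨D, hD⟩ := h.exists_dist_le
  refine locallyConnectedSpace_of_covers fun ε hε => ?_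
  obtain ⟨n, hn⟩ := h.exists_mul_pow_lt D hε
  obtain ⟨F, hF, hFL, hFs⟩ := h.exists_cover hD n c
  exact ⟨F, hF, hFL, fun s hs => ⟨(hFs s hs).1.isClosed, (hFs s hs).2.1,
    fun x hx y hy => ((hFs s hs).2.2 x hx y hy).trans_lt hn⟩⟩

/-- A set without cut points lies in a single piece; pulled back by the similarity of that piece it
is again such a set, so each level gains a factor `r`. -/
theorem dist_le_of_isPreconnected_sdiff [∀ c, Finite (ι c)] (h : TreeLikeSystem G f col L r) {D : ℝ}
    (hD : ∀ c, ∀ x ∈ L c, ∀ y ∈ L c, dist x y ≤ D) (n : ℕ) :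
    ∀ (c : κ) (C : Set X), C ⊆ L c → C.Infinite → (∀ x, IsPreconnected (C \ {x})) →
      ∀ x ∈ C, ∀ y ∈ C, dist x y ≤ D * r ^ n := by
  induction n with
  | zero =>
    intro c C hC _ _ x hx y hy
    simpa using hD c x (hC hx) y (hC hy)
  | succ n ih =>
    intro c C hC hinf hCp
    obtain ⟨i, hi⟩ := (h.isTree c).subset_of_forall_isPreconnected_diff
      (K := fun i => f c i '' L (col c i))
      (fun i => ((h.isCompact _).image (h.isEmbedding c i).continuous).isClosed)
      (h.inter_nonempty c) (h.adj c) (h.inter_subsingleton c)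
      (hC.trans (h.eq_iUnion c).subset) hinf hCp
    obtain ⟨C, hCL, rfl⟩ := subset_image_iff.1 hi
    have hinj := (h.isEmbedding c i).injective
    have hd := ih (col c i) C hCL hinf.of_image fun x => by
      rw [← (h.isEmbedding c i).isInducing.isPreconnected_image, image_sdiff hinj, image_singleton]
      exact hCp _
    rintro _ ⟨x, hx, rfl⟩ _ ⟨y, hy, rfl⟩
    rw [h.dist_eq, pow_succ', mul_left_comm]
    exact mul_le_mul_of_nonneg_left (hd x hx y hy) h.pos.le

theorem not_isSimpleClosedCurve [Finite κ] [∀ c, Finite (ι c)] (h : TreeLikeSystem G f col L r)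
    {c : κ} {C : Set X} (hC : C ⊆ L c) : ¬TriLabyrinth.IsSimpleClosedCurve C := by
  intro hcurve
  obtain ⟨D, hD⟩ := h.exists_dist_le
  obtain ⟨x, hx, y, hy, hxy⟩ := hcurve.infinite.nontrivial
  obtain ⟨n, hn⟩ := h.exists_mul_pow_lt D (dist_pos.2 hxy)
  exact (h.dist_le_of_isPreconnected_sdiff hD n c C hC hcurve.infinite
    hcurve.isPreconnected_sdiff_singleton x hx y hy).not_gt hn

theorem isDendrite {L : κ → Set TriLabyrinth.Plane}
    {f : ∀ c, ι c → TriLabyrinth.Plane → TriLabyrinth.Plane} [Finite κ]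
    [∀ c, Finite (ι c)] (h : TreeLikeSystem G f col L r) (c : κ) :
    TriLabyrinth.IsDendrite (L c) where
  isCompact := h.isCompact c
  isConnected := h.isConnected c
  locallyConnected := h.locallyConnectedSpace c
  noSimpleClosedCurve := fun _ => h.not_isSimpleClosedCurve

end TreeLikeSystem

/-! ### Homogeneous coordinates and the maps `proj` -/

namespace TriLabyrinth

theorem coord_injective : Function.Injective coord := fun x y h => by
  rw [← sum_coord_smul x, ← sum_coord_smul y, h]

/-- Homogeneous coordinates are affine functions. The same then holds for `proj`, whence the
associativity of `projTriangle`. -/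
theorem coord_sum (a : Fin 3 → ℝ) (ha : ∑ i, a i = 1) (y : Fin 3 → Plane) (j : Fin 3) :
    coord (∑ i, a i • y i) j = ∑ i, a i * coord (y i) j := by
  have h0 : a 0 = 1 - a 1 - a 2 := by
    rw [Fin.sum_univ_three] at ha
    linarith
  fin_cases j <;> simp [coord, Fin.sum_univ_three, h0] <;> ring

theorem coord_P (i : Fin 3) : coord (P i) = Pi.single i 1 := by
  have h := coord_sum_smul (Pi.single i 1) (by simp)
  rwa [← Fintype.linearCombination_apply ℝ, Fintype.linearCombination_apply_single, one_smul] at h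

theorem continuous_coord (i : Fin 3) : Continuous fun x => coord x i := by
  fin_cases i <;> simp only [coord, Fin.zero_eta, Fin.mk_one, Fin.reduceFinMk, Matrix.cons_val] <;>
    fun_prop

theorem proj_sum (A : Triangle) (a : Fin 3 → ℝ) (ha : ∑ i, a i = 1) (y : Fin 3 → Plane) :
    A.proj (∑ i, a i • y i) = ∑ i, a i • A.proj (y i) := by
  simp only [Triangle.proj, coord_sum a ha, Finset.sum_smul, Finset.smul_sum, smul_smul]
  exact Finset.sum_comm

theorem proj_projTriangle (A B : Triangle) (x : Plane) :
    (A.projTriangle B).proj x = A.proj (B.proj x) :=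
  (proj_sum A _ (sum_coord x) B).symm

theorem projTriangle_assoc (A B C : Triangle) :
    (A.projTriangle B).projTriangle C = A.projTriangle (B.projTriangle C) :=
  funext fun i => proj_projTriangle A B (C i)

/-- The full triangle with vertices `P₁, P₂, P₃`. -/
def simplex : Set Plane := {x | ∀ i, 0 ≤ coord x i}

theorem full_eq_image (A : Triangle) : A.full = A.proj '' simplex := by
  have hr : range A = Fintype.linearCombination ℝ A '' range fun i : Fin 3 => Pi.single i (1 : ℝ) := by
    rw [← range_comp]
    congr 1
    ext1 i
    simp [Fintype.linearCombination_apply_single]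
  rw [Triangle.full, hr, ← LinearMap.image_convexHull, convexHull_rangle_single_eq_stdSimplex]
  ext x
  constructor
  · rintro ⟨w, ⟨hw, hw1⟩, rfl⟩
    refine ⟨∑ i, w i • P i, fun i => ?_, ?_⟩
    · rw [coord_sum_smul w hw1]
      exact hw i
    · rw [Triangle.proj, coord_sum_smul w hw1, Fintype.linearCombination_apply]
  · rintro ⟨y, hy, rfl⟩
    exact ⟨coord y, ⟨hy, sum_coord y⟩, by rw [Fintype.linearCombination_apply, Triangle.proj]⟩

theorem full_projTriangle (A B : Triangle) : (A.projTriangle B).full = A.proj '' B.full := by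
  rw [full_eq_image, full_eq_image, image_image]
  exact image_congr fun x _ => proj_projTriangle A B x

theorem proj_P (x : Plane) : Triangle.proj P x = x := sum_coord_smul x

theorem isCompact_simplex : IsCompact simplex := by
  have h : simplex = P.full := by
    rw [full_eq_image]
    simp [funext proj_P]
  rw [h]
  exact (finite_range P).isCompact_convexHull ℝ

theorem coord_le_one {x : Plane} (hx : x ∈ simplex) (i : Fin 3) : coord x i ≤ 1 := by
  rw [← sum_coord x]
  exact Finset.single_le_sum (fun i _ => hx i) (Finset.mem_univ i)

/-- Applied with `s = 1 / m` for upright cells and `s = -(1 / m)` for upside down ones: the latter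
are reflected through a point. -/
theorem proj_of_smul_add {A : Triangle} {s : ℝ} {c : Plane} (h : ∀ i, A i = s • P i + c)
    (x : Plane) : A.proj x = s • x + c := by
  conv_rhs => rw [← sum_coord_smul x]
  simp only [Triangle.proj, h, smul_add, Finset.sum_add_distrib, ← Finset.sum_smul, sum_coord,
    one_smul, Finset.smul_sum]
  simp only [smul_smul, mul_comm]

theorem proj_up (m : ℕ) (k : Fin 3 → ℕ) (x : Plane) :
    (up m k).proj x = (1 / m : ℝ) • x + (1 / m : ℝ) • ∑ j, (k j : ℝ) • P j := by
  refine proj_of_smul_add (fun i => ?_) x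
  simp [up, add_smul, Finset.sum_add_distrib, add_comm]

theorem proj_down (m : ℕ) (k : Fin 3 → ℕ) (x : Plane) :
    (down m k).proj x = (-(1 / m : ℝ)) • x + (1 / m : ℝ) • ∑ j, (k j + 1 : ℝ) • P j := by
  refine proj_of_smul_add (fun i => ?_) x
  have h : ∀ j, ((k j : ℝ) + if j = i then 0 else 1) = (k j + 1) - if j = i then 1 else 0 := by
    intro j
    split_ifs <;> ring
  simp only [down, h, sub_smul, Finset.sum_sub_distrib, smul_sub, ite_smul, one_smul, zero_smul,
    Finset.sum_ite_eq', Finset.mem_univ, if_true, neg_smul]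
  abel

theorem coord_proj_up {m : ℕ} {k : Fin 3 → ℕ} (hk : ∑ i, k i + 1 = m) (x : Plane) (j : Fin 3) :
    coord ((up m k).proj x) j = (k j + coord x j) / m := by
  have hm : (m : ℝ) ≠ 0 := by
    rw [Nat.cast_ne_zero]
    omega
  have h : (up m k).proj x = ∑ j, ((k j + coord x j) / m : ℝ) • P j := by
    rw [proj_up]
    conv_lhs => rw [← sum_coord_smul x]
    simp only [Finset.smul_sum, ← Finset.sum_add_distrib, smul_smul, ← add_smul]
    refine Finset.sum_congr rfl fun j _ => ?_
    congr 1
    ring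
  rw [h, coord_sum_smul]
  rw [← Finset.sum_div, Finset.sum_add_distrib, sum_coord, div_eq_one_iff_eq hm, ← hk]
  push_cast
  rfl

theorem coord_proj_down {m : ℕ} {k : Fin 3 → ℕ} (hk : ∑ i, k i + 2 = m) (x : Plane) (j : Fin 3) :
    coord ((down m k).proj x) j = (k j + 1 - coord x j) / m := by
  have hm : (m : ℝ) ≠ 0 := by
    rw [Nat.cast_ne_zero]
    omega
  have h : (down m k).proj x = ∑ j, ((k j + 1 - coord x j) / m : ℝ) • P j := by
    rw [proj_down]
    conv_lhs => rw [← sum_coord_smul x]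
    simp only [Finset.smul_sum, ← Finset.sum_add_distrib, smul_smul, ← add_smul]
    refine Finset.sum_congr rfl fun j _ => ?_
    congr 1
    ring
  rw [h, coord_sum_smul]
  rw [← Finset.sum_div, Finset.sum_sub_distrib, sum_coord, div_eq_one_iff_eq hm, ← hk,
    Finset.sum_add_distrib]
  push_cast
  simp only [Finset.sum_const, Finset.card_univ, Fintype.card_fin, nsmul_eq_mul]
  norm_num
  ring

theorem up_injective {m : ℕ} {k l : Fin 3 → ℕ} (hk : ∑ i, k i + 1 = m) (hl : ∑ i, l i + 1 = m)
    (h : up m k = up m l) : k = l := by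
  have hm : (m : ℝ) ≠ 0 := by
    rw [Nat.cast_ne_zero]
    omega
  ext j
  have hj := coord_proj_up hk (P 0) j
  rw [h, coord_proj_up hl, div_left_inj' hm, add_left_inj, Nat.cast_inj] at hj
  exact hj.symm

/-- The linear parts have opposite signs, as the first coordinate at `P 0` and `P 1` shows. -/
theorem up_ne_down {m : ℕ} {k l : Fin 3 → ℕ} (hk : ∑ i, k i + 1 = m) (hl : ∑ i, l i + 2 = m) :
    up m k ≠ down m l := by
  intro h
  have hm : (m : ℝ) ≠ 0 := by
    rw [Nat.cast_ne_zero]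
    omega
  have h0 := coord_proj_up hk (P 0) 0
  have h1 := coord_proj_up hk (P 1) 0
  rw [h, coord_proj_down hl, div_left_inj' hm, coord_P] at h0 h1
  simp at h0 h1
  linarith

theorem disjoint_upTriangles_downTriangles (m : ℕ) :
    Disjoint (upTriangles m) (downTriangles m) := by
  rw [Set.disjoint_left]
  rintro _ ⟨k, hk, rfl⟩ ⟨l, hl, h⟩
  exact up_ne_down hk hl h

theorem finite_upTriangles (m : ℕ) : (upTriangles m).Finite := by
  refine ((finite_Iic fun _ : Fin 3 => m).image (up m)).subset ?_
  rintro _ ⟨k, hk, rfl⟩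
  refine mem_image_of_mem _ fun i => ?_
  have : k i ≤ ∑ i, k i := Finset.single_le_sum (f := k) (fun i _ => (k i).zero_le) (Finset.mem_univ i)
  show k i ≤ m
  omega

theorem finite_downTriangles (m : ℕ) : (downTriangles m).Finite := by
  refine ((finite_Iic fun _ : Fin 3 => m).image (down m)).subset ?_
  rintro _ ⟨k, hk, rfl⟩
  refine mem_image_of_mem _ fun i => ?_
  have : k i ≤ ∑ i, k i := Finset.single_le_sum (f := k) (fun i _ => (k i).zero_le) (Finset.mem_univ i)
  show k i ≤ m
  omega

theorem dist_proj {m : ℕ} {A : Triangle} (hA : A ∈ upTriangles m ∪ downTriangles m) (x y : Plane) :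
    dist (A.proj x) (A.proj y) = (1 / m : ℝ) * dist x y := by
  rcases hA with ⟨k, -, rfl⟩ | ⟨k, -, rfl⟩
  · rw [proj_up, proj_up, dist_add_right, dist_smul₀]
    simp
  · rw [proj_down, proj_down, dist_add_right, dist_smul₀]
    simp

theorem proj_mem_simplex {m : ℕ} {A : Triangle} (hA : A ∈ upTriangles m ∪ downTriangles m)
    {x : Plane} (hx : x ∈ simplex) : A.proj x ∈ simplex := by
  intro i
  rcases hA with ⟨k, hk, rfl⟩ | ⟨k, hk, rfl⟩
  · rw [coord_proj_up hk]
    have := hx i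
    positivity
  · rw [coord_proj_down hk]
    have := coord_le_one hx i
    exact div_nonneg (by linarith [(k i).cast_nonneg (α := ℝ)]) (by positivity)

/-! ### The fractals as attractors -/

namespace PatternsSystem

variable {m : ℕ} (S : PatternsSystem m)

/-- The upright triangles of the white (`true`) or yellow (`false`) pattern. -/
def ups : Bool → Set Triangle
  | true => S.W
  | false => S.Y

/-- The upside down triangles of the white (`true`) or yellow (`false`) pattern. -/
def downs : Bool → Set Triangle
  | true => S.W'
  | false => S.Y'

/-- The white (`true`) or yellow (`false`) pattern. -/
def cells (c : Bool) : Set Triangle := S.ups c ∪ S.downs c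

/-- The triangles of level `n + 1` of the given colour. -/
def level : Bool → ℕ → Set Triangle × Set Triangle
  | true => S.white
  | false => S.yellow

open Classical in
/-- The colour of the pattern that refines the triangle `A` of the pattern of colour `c`. -/
noncomputable def refinement (_S : PatternsSystem m) (c : Bool) (A : Triangle) : Bool :=
  if A ∈ upTriangles m then c else !c

/-- The union of the triangles of level `n` of the given colour. -/
noncomputable def approx : ℕ → Bool → Set Plane
  | 0, _ => simplex
  | n + 1, c => ⋃ A : S.cells c, A.1.proj '' approx n (S.refinement c A)

/-- The fractal of the given colour. -/
noncomputable def fractal (c : Bool) : Set Plane := ⋂ n, S.approx n c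

theorem ups_subset : ∀ c, S.ups c ⊆ upTriangles m
  | true => S.W_subset
  | false => S.Y_subset

theorem downs_subset : ∀ c, S.downs c ⊆ downTriangles m
  | true => S.W'_subset
  | false => S.Y'_subset

theorem cells_subset (c : Bool) : S.cells c ⊆ upTriangles m ∪ downTriangles m :=
  union_subset_union (S.ups_subset c) (S.downs_subset c)

instance finite_cells (c : Bool) : Finite (S.cells c) :=
  (((finite_upTriangles m).union (finite_downTriangles m)).subset (S.cells_subset c)).to_subtype

theorem refinement_of_mem_ups {c : Bool} {A : Triangle} (hA : A ∈ S.ups c) :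
    S.refinement c A = c :=
  if_pos (S.ups_subset c hA)

theorem refinement_of_mem_downs {c : Bool} {A : Triangle} (hA : A ∈ S.downs c) :
    S.refinement c A = !c :=
  if_neg ((disjoint_upTriangles_downTriangles m).notMem_of_mem_right (S.downs_subset c hA))

theorem iUnion_cells (c : Bool) (K : Bool → Set Plane) :
    ⋃ A : S.cells c, A.1.proj '' K (S.refinement c A) =
      (⋃ A ∈ S.ups c, A.proj '' K c) ∪ ⋃ A ∈ S.downs c, A.proj '' K (!c) := by
  rw [← biUnion_eq_iUnion (S.cells c) fun A _ => A.proj '' K (S.refinement c A), cells,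
    biUnion_union]
  congr 1
  · exact iUnion₂_congr fun A hA => by rw [S.refinement_of_mem_ups hA]
  · exact iUnion₂_congr fun A hA => by rw [S.refinement_of_mem_downs hA]

theorem level_zero (c : Bool) : S.level c 0 = (S.ups c, S.downs c) := by
  cases c <;> rfl

theorem level_succ (c : Bool) (n : ℕ) :
    S.level c (n + 1) =
      (image2 Triangle.projTriangle (S.level c n).1 (S.ups c) ∪
        image2 Triangle.projTriangle (S.level c n).2 (S.downs !c),
      image2 Triangle.projTriangle (S.level c n).1 (S.downs c) ∪
        image2 Triangle.projTriangle (S.level c n).2 (S.ups !c)) := by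
  cases c <;> rfl

/-- The levels are defined by subdividing the smallest triangles, whereas self-similarity needs the
outermost triangle split off. Associativity of `projTriangle` lets the recursion be read from either
end. -/
theorem level_succ' (n : ℕ) : ∀ c,
    S.level c (n + 1) =
      (image2 Triangle.projTriangle (S.ups c) (S.level c n).1 ∪
        image2 Triangle.projTriangle (S.downs c) (S.level (!c) n).2,
      image2 Triangle.projTriangle (S.ups c) (S.level c n).2 ∪
        image2 Triangle.projTriangle (S.downs c) (S.level (!c) n).1) := by
  induction n with
  | zero =>
    intro c
    rw [level_succ, level_zero, level_zero]
  | succ n ih =>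
    intro c
    conv_lhs => rw [level_succ, ih]
    rw [S.level_succ c n, S.level_succ (!c) n, Bool.not_not]
    simp only [image2_union_left, image2_union_right, image2_assoc projTriangle_assoc]
    congr 1 <;> ac_rfl

theorem approx_succ (n : ℕ) : ∀ c, S.approx (n + 1) c =
    (⋃ A ∈ (S.level c n).1, A.full) ∪ ⋃ A ∈ (S.level c n).2, A.full := by
  induction n with
  | zero =>
    intro c
    rw [approx, S.iUnion_cells c (S.approx 0), level_zero]
    simp only [full_eq_image, approx]
  | succ n ih =>
    intro c
    rw [approx, S.iUnion_cells c (S.approx (n + 1)), ih, ih, level_succ']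
    simp only [biUnion_union, biUnion_image2, full_projTriangle, image_union, image_iUnion,
      iUnion_union_distrib]
    ac_rfl

theorem approx_succ_subset (n : ℕ) : ∀ c, S.approx (n + 1) c ⊆ S.approx n c := by
  induction n with
  | zero =>
    refine fun c => iUnion_subset fun A => ?_
    rintro _ ⟨x, hx, rfl⟩
    exact proj_mem_simplex (S.cells_subset c A.2) hx
  | succ n ih => exact fun c => iUnion_mono fun A => image_mono (ih _)

theorem antitone_approx (c : Bool) : Antitone fun n => S.approx n c :=
  antitone_nat_of_succ_le fun n => S.approx_succ_subset n c

theorem fractal_eq_iInter (c : Bool) : S.fractal c = ⋂ n,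
    ((⋃ A ∈ (S.level c n).1, A.full) ∪ ⋃ A ∈ (S.level c n).2, A.full) := by
  simp only [← approx_succ]
  exact ((S.antitone_approx c).iInf_nat_add 1).symm

theorem whiteFractal_eq : S.whiteFractal = S.fractal true := (S.fractal_eq_iInter true).symm

theorem yellowFractal_eq : S.yellowFractal = S.fractal false := (S.fractal_eq_iInter false).symm

theorem fractal_subset_simplex (c : Bool) : S.fractal c ⊆ simplex := iInter_subset _ 0

variable {S}

theorem proj_injective (hm : m ≠ 0) {c : Bool} {A : Triangle} (hA : A ∈ S.cells c) :
    Function.Injective A.proj := by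
  intro x y h
  rw [← dist_eq_zero, dist_proj (S.cells_subset c hA)] at h
  have : (1 / m : ℝ) ≠ 0 := by positivity
  exact dist_eq_zero.1 ((mul_eq_zero.1 h).resolve_left this)

/-- A decreasing intersection commutes with a finite union, and any intersection with injective
images. -/
theorem fractal_eq_iUnion (hm : m ≠ 0) (c : Bool) :
    S.fractal c = ⋃ A : S.cells c, A.1.proj '' S.fractal (S.refinement c A) := by
  have h1 : S.fractal c = ⋂ n, S.approx (n + 1) c :=
    ((S.antitone_approx c).iInf_nat_add 1).symm
  simp only [h1, approx]
  rw [iInter_iUnion_of_antitone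
    (s := fun (A : S.cells c) n => A.1.proj '' S.approx n (S.refinement c A))
    fun A => fun n n' h => image_mono (S.antitone_approx _ h)]
  refine iUnion_congr fun A => ?_
  rw [fractal, (proj_injective hm A.2).injOn.image_iInter_eq]

theorem isCompact_approx (n : ℕ) : ∀ c, IsCompact (S.approx n c) := by
  induction n with
  | zero => exact fun _ => isCompact_simplex
  | succ n ih =>
    refine fun c => isCompact_iUnion fun A => (ih _).image ?_
    exact continuous_finsetSum _ fun i _ => (continuous_coord i).smul continuous_const

theorem isCompact_fractal (c : Bool) : IsCompact (S.fractal c) :=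
  (isCompact_approx (S := S) 0 c).of_isClosed_subset (isClosed_iInter fun n => (isCompact_approx n c).isClosed)
    (S.fractal_subset_simplex c)

/-- An upright cell keeps the colour, so its fixed point survives every refinement. -/
theorem mem_fractal_of_proj_eq {c : Bool} {A : Triangle} (hA : A ∈ S.ups c) {x : Plane}
    (hx : x ∈ simplex) (h : A.proj x = x) : x ∈ S.fractal c := by
  refine mem_iInter.2 fun n => ?_
  induction n with
  | zero => exact hx
  | succ n ih =>
    refine mem_iUnion.2 ⟨⟨A, Or.inl hA⟩, x, ?_, h⟩
    rwa [S.refinement_of_mem_ups hA]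

end PatternsSystem

end TriLabyrinth

/-! ### Corner points and side points of the fractals -/

namespace TriLabyrinth

/-- Names the two indices other than `j`, so that the three sides can be treated alike. -/
theorem exists_others (j : Fin 3) : ∃ a b : Fin 3, a ≠ j ∧ b ≠ j ∧ a ≠ b ∧
    (∀ i, i = j ∨ i = a ∨ i = b) ∧ (∀ f : Fin 3 → ℕ, ∑ i, f i = f j + f a + f b) ∧
    ∀ x, coord x j + coord x a + coord x b = 1 := by
  have h (x : Plane) := (Fin.sum_univ_three (coord x)).symm.trans (sum_coord x)
  fin_cases j
  · exact ⟨1, 2, by decide, by decide, by decide, by decide,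
      fun f => Fin.sum_univ_three f, fun x => h x⟩
  · refine ⟨0, 2, by decide, by decide, by decide, by decide, fun f => ?_, fun x => ?_⟩
    · rw [Fin.sum_univ_three, add_comm (f 0)]
      rfl
    · rw [← h x, add_comm (coord x 0)]
      rfl
  · refine ⟨0, 1, by decide, by decide, by decide, by decide, fun f => ?_, fun x => ?_⟩
    · rw [Fin.sum_univ_three, add_comm _ (f 2), ← add_assoc]
      rfl
    · rw [← h x, add_comm _ (coord x 2), ← add_assoc]
      rfl

theorem coord_eq_zero_of_coord_eq_one {x : Plane} (hx : x ∈ simplex) {i j : Fin 3}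
    (hi : coord x i = 1) (hj : j ≠ i) : coord x j = 0 := by
  obtain ⟨a, b, -, -, -, h, -, hsum⟩ := exists_others i
  have := hsum x
  have ha := hx a
  have hb := hx b
  rcases h j with rfl | rfl | rfl
  · exact absurd rfl hj
  · linarith
  · linarith

/-- `x` and `y` lie on the side opposite to `P j` and are symmetric with respect to its midpoint. -/
def MirrorPoints (j : Fin 3) (x y : Plane) : Prop :=
  coord x j = 0 ∧ coord y j = 0 ∧ ∀ i, i ≠ j → coord x i + coord y i = 1

theorem MirrorPoints.symm {j : Fin 3} {x y : Plane} (h : MirrorPoints j x y) :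
    MirrorPoints j y x :=
  ⟨h.2.1, h.1, fun i hi => by rw [add_comm, h.2.2 i hi]⟩

/-- The upright triangles with indices `k` and `l` of `𝒯_m` touch the side opposite to `P j` in
segments that are symmetric with respect to its midpoint. -/
structure MirrorIndices (m : ℕ) (j : Fin 3) (k l : Fin 3 → ℕ) : Prop where
  sum_left : ∑ i, k i + 1 = m
  sum_right : ∑ i, l i + 1 = m
  left : k j = 0
  right : l j = 0
  add : ∀ i, i ≠ j → k i + l i + 1 = m

theorem MirrorIndices.symm {m : ℕ} {j : Fin 3} {k l : Fin 3 → ℕ} (h : MirrorIndices m j k l) :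
    MirrorIndices m j l k :=
  ⟨h.sum_right, h.sum_left, h.right, h.left, fun i hi => by rw [add_comm (l i), h.add i hi]⟩

/-- The triple with `0` in position `j` and the entries `t, u`, in this order, elsewhere. -/
def sideIndex (j : Fin 3) (t u : ℕ) : Fin 3 → ℕ :=
  (![![0, t, u], ![t, 0, u], ![t, u, 0]] : Fin 3 → Fin 3 → ℕ) j

theorem sum_sideIndex (j : Fin 3) (t u : ℕ) : ∑ i, sideIndex j t u i = t + u := by
  fin_cases j <;> simp [sideIndex, Fin.sum_univ_three]

theorem mirrorIndices_sideIndex {m : ℕ} (j : Fin 3) {t : ℕ} (ht : t < m) :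
    MirrorIndices m j (sideIndex j t (m - 1 - t)) (sideIndex j (m - 1 - t) t) := by
  have h1 : t + (m - 1 - t) + 1 = m := by omega
  have h2 : m - 1 - t + t + 1 = m := by omega
  refine ⟨by rwa [sum_sideIndex], by rwa [sum_sideIndex], ?_, ?_, fun i hi => ?_⟩
  · fin_cases j <;> rfl
  · fin_cases j <;> rfl
  fin_cases j <;> fin_cases i
  exacts [absurd rfl hi, h1, h2, h1, absurd rfl hi, h2, h1, h2, absurd rfl hi]

theorem MirrorIndices.exists_eq_sideIndex {m : ℕ} {j : Fin 3} {k l : Fin 3 → ℕ}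
    (h : MirrorIndices m j k l) :
    ∃ t < m, k = sideIndex j t (m - 1 - t) ∧ l = sideIndex j (m - 1 - t) t := by
  obtain ⟨hk, hl, hkj, hlj, h⟩ := h
  rw [Fin.sum_univ_three] at hk hl
  have h0 := h 0
  have h1 := h 1
  have h2 := h 2
  fin_cases j <;> simp at hkj hlj h0 h1 h2
  · refine ⟨k 1, by omega, ?_, ?_⟩ <;> funext i <;> fin_cases i <;> simp [sideIndex] <;> omega
  · refine ⟨k 0, by omega, ?_, ?_⟩ <;> funext i <;> fin_cases i <;> simp [sideIndex] <;> omega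
  · refine ⟨k 0, by omega, ?_, ?_⟩ <;> funext i <;> fin_cases i <;> simp [sideIndex] <;> omega

theorem exists_lt_of_sum_eq {k l : Fin 3 → ℕ} (h : ∑ i, k i = ∑ i, l i) (hne : k ≠ l) :
    ∃ i, k i < l i := by
  by_contra! hle
  exact hne (funext fun i => ((Finset.sum_eq_sum_iff_of_le fun i _ => hle i).1 h.symm i
    (Finset.mem_univ i)).symm)

theorem up_single_apply {m : ℕ} (hm : m ≠ 0) (i : Fin 3) :
    (up m (Pi.single i (m - 1))).proj (P i) = P i := by
  have hsum : ∑ j, (Pi.single i (m - 1) : Fin 3 → ℕ) j + 1 = m := by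
    rw [Finset.sum_pi_single']
    simp only [Finset.mem_univ, if_true]
    omega
  refine coord_injective (funext fun j => ?_)
  rw [coord_proj_up hsum, coord_P]
  by_cases h : j = i
  · subst h
    have h1 : 1 ≤ m := Nat.one_le_iff_ne_zero.2 hm
    have h0 : (m : ℝ) ≠ 0 := Nat.cast_ne_zero.2 hm
    rw [Pi.single_eq_same, Pi.single_eq_same]
    push_cast [h1]
    field_simp
    ring
  · rw [Pi.single_eq_of_ne h, Pi.single_eq_of_ne h]
    simp

namespace PatternsSystem

variable {m : ℕ} {S : PatternsSystem m} {c : Bool}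

theorem mem_fractal_cases (hm : m ≠ 0) {x : Plane} (hx : x ∈ S.fractal c) :
    (∃ k, ∑ i, k i + 1 = m ∧ up m k ∈ S.ups c ∧ ∃ y ∈ S.fractal c, (up m k).proj y = x) ∨
      ∃ k, ∑ i, k i + 2 = m ∧ down m k ∈ S.downs c ∧
        ∃ y ∈ S.fractal (!c), (down m k).proj y = x := by
  rw [fractal_eq_iUnion hm, S.iUnion_cells c S.fractal] at hx
  rcases hx with h | h
  · obtain ⟨A, hA, y, hy, rfl⟩ := mem_iUnion₂.1 h
    obtain ⟨k, hk, rfl⟩ := S.ups_subset c hA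
    exact Or.inl ⟨k, hk, hA, y, hy, rfl⟩
  · obtain ⟨A, hA, y, hy, rfl⟩ := mem_iUnion₂.1 h
    obtain ⟨k, hk, rfl⟩ := S.downs_subset c hA
    exact Or.inr ⟨k, hk, hA, y, hy, rfl⟩

/-- Turns the corners property, a statement about cells, into one about points: only the corner cell
at `P i` contains `P i`. -/
theorem up_single_mem_corners (hm : m ≠ 0) {x : Plane} (hx : x ∈ S.fractal c) {i : Fin 3}
    (hi : coord x i = 1) : up m (Pi.single i (m - 1)) ∈ corners (S.ups c) := by
  have hm' : (0 : ℝ) < m := by positivity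
  obtain ⟨a, b, ha, hb, hab, hall, hN, hR⟩ := exists_others i
  have hxa := coord_eq_zero_of_coord_eq_one (S.fractal_subset_simplex c hx) hi ha
  have hxb := coord_eq_zero_of_coord_eq_one (S.fractal_subset_simplex c hx) hi hb
  refine ⟨?_, P i, ?_, mem_range_self i⟩
  · rcases mem_fractal_cases hm hx with ⟨k, hk, hkS, y, hy, rfl⟩ | ⟨k, hk, hkS, y, hy, rfl⟩
    · rw [coord_proj_up hk, div_eq_zero_iff, or_iff_left hm'.ne'] at hxa hxb
      have hya := S.fractal_subset_simplex c hy a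
      have hyb := S.fractal_subset_simplex c hy b
      have hka : (k a : ℝ) = 0 := by linarith [(k a).cast_nonneg (α := ℝ)]
      have hkb : (k b : ℝ) = 0 := by linarith [(k b).cast_nonneg (α := ℝ)]
      rw [Nat.cast_eq_zero] at hka hkb
      have : k = Pi.single i (m - 1) := by
        funext j
        rcases hall j with rfl | rfl | rfl
        · rw [Pi.single_eq_same]
          have := hN k
          omega
        · rw [Pi.single_eq_of_ne ha, hka]
        · rw [Pi.single_eq_of_ne hb, hkb]
      rwa [← this]
    · rw [coord_proj_down hk, div_eq_zero_iff, or_iff_left hm'.ne'] at hxa hxb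
      have hyi := S.fractal_subset_simplex (!c) hy i
      linarith [hR y, (k a).cast_nonneg (α := ℝ), (k b).cast_nonneg (α := ℝ)]
  · rw [full_eq_image]
    refine ⟨P i, fun j => ?_, up_single_apply hm i⟩
    rw [coord_P]
    exact (Pi.single_nonneg.2 zero_le_one : (0 : Fin 3 → ℝ) ≤ Pi.single i 1) j

theorem IsLabyrinth.encard_corners_le (hS : S.IsLabyrinth) :
    ∀ c, (TriLabyrinth.corners (S.ups c)).encard ≤ 1
  | true => hS.corners.2.1
  | false => hS.corners.2.2

theorem IsLabyrinth.inter_corners (hS : S.IsLabyrinth) :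
    ∀ c, TriLabyrinth.corners (S.ups c) ∩ TriLabyrinth.corners (S.ups !c) = ∅
  | true => hS.corners.1
  | false => (inter_comm _ _).trans hS.corners.1

theorem IsLabyrinth.corner_unique (hS : S.IsLabyrinth) (hm : 2 ≤ m) {x y : Plane}
    (hx : x ∈ S.fractal c) (hy : y ∈ S.fractal c) {i j : Fin 3} (hi : coord x i = 1)
    (hj : coord y j = 1) : i = j := by
  have hm0 : m ≠ 0 := by omega
  have h := encard_le_one_iff.1 (hS.encard_corners_le c) _ _ (up_single_mem_corners hm0 hx hi)
    (up_single_mem_corners hm0 hy hj)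
  have hsum (i : Fin 3) : ∑ j, (Pi.single i (m - 1) : Fin 3 → ℕ) j + 1 = m := by
    rw [Finset.sum_pi_single']
    simp only [Finset.mem_univ, if_true]
    omega
  by_contra hij
  -- Distinct corners have distinct corner cells because `m - 1 ≠ 0`.
  have := congrFun (up_injective (hsum i) (hsum j) h) i
  rw [Pi.single_eq_same, Pi.single_eq_of_ne hij] at this
  omega

theorem IsLabyrinth.corner_disjoint (hS : S.IsLabyrinth) (hm : 2 ≤ m) {x y : Plane}
    (hx : x ∈ S.fractal c) (hy : y ∈ S.fractal !c) {i : Fin 3} (hi : coord x i = 1) :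
    coord y i ≠ 1 := fun hi' => by
  have hm0 : m ≠ 0 := by omega
  exact (hS.inter_corners c).subset
    ⟨up_single_mem_corners hm0 hx hi, up_single_mem_corners hm0 hy hi'⟩

theorem IsLabyrinth.exists_mirrorIndices_true (hS : S.IsLabyrinth) (j : Fin 3) :
    ∃ k l, MirrorIndices m j k l ∧ up m k ∈ S.W ∧
      up m l ∈ S.Y ∧ ∀ k' l', MirrorIndices m j k' l' → up m k' ∈ S.W → up m l' ∈ S.Y →
        k' = k ∧ l' = l := by
  let Q (i : Fin 3) (t : ℕ) : Prop :=
    t < m ∧ up m (sideIndex i t (m - 1 - t)) ∈ S.W ∧ up m (sideIndex i (m - 1 - t) t) ∈ S.Y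
  obtain ⟨e, ⟨hlt, h0, h1, h2⟩, huniq⟩ := hS.exits
  have hQ : ∀ i, Q i (e i) := by
    intro i
    refine ⟨hlt i, ?_⟩
    fin_cases i
    exacts [h0, h1, h2]
  have huniq : ∀ i t, Q i t → t = e i := by
    intro i t ht
    -- Uniqueness of the triple gives uniqueness on each side: another exit on side `i` could
    -- replace the entry `e i` alone.
    have hQ' : ∀ i', Q i' (Function.update e i t i') := by
      intro i'
      by_cases h : i' = i
      · rw [h, Function.update_self]
        exact ht
      · rw [Function.update_of_ne h]
        exact hQ i'
    rw [← huniq _ ⟨fun i => (hQ' i).1, (hQ' 0).2, (hQ' 1).2, (hQ' 2).2⟩, Function.update_self]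
  refine ⟨_, _, mirrorIndices_sideIndex j (hlt j), (hQ j).2.1, (hQ j).2.2,
    fun k l hkl hk hl => ?_⟩
  obtain ⟨t, ht, rfl, rfl⟩ := hkl.exists_eq_sideIndex
  rw [huniq j t ⟨ht, hk, hl⟩]
  exact ⟨rfl, rfl⟩

theorem IsLabyrinth.exists_mirrorIndices (hS : S.IsLabyrinth) (c : Bool) (j : Fin 3) :
    ∃ k l, MirrorIndices m j k l ∧ up m k ∈ S.ups c ∧
      up m l ∈ S.ups (!c) ∧ ∀ k' l', MirrorIndices m j k' l' → up m k' ∈ S.ups c →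
        up m l' ∈ S.ups (!c) → k' = k ∧ l' = l := by
  obtain ⟨k, l, hkl, hkW, hlY, h⟩ := hS.exists_mirrorIndices_true j
  cases c
  · exact ⟨l, k, hkl.symm, hlY, hkW, fun l' k' hlk' hl' hk' =>
      (h k' l' hlk'.symm hk' hl').symm⟩
  · exact ⟨k, l, hkl, hkW, hlY, h⟩

/-- The fixed point of `(up m k).proj` has coordinates `k i / (m - 1)`, and mirror indices have
mirror fixed points. -/
theorem IsLabyrinth.exists_mirrorPoints (hS : S.IsLabyrinth) (hm : 2 ≤ m) (c : Bool) (j : Fin 3) :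
    ∃ x ∈ S.fractal c, ∃ y ∈ S.fractal !c, MirrorPoints j x y := by
  obtain ⟨k, l, hkl, hkW, hlY, -⟩ := hS.exists_mirrorIndices c j
  have hk := hkl.sum_left
  have hl := hkl.sum_right
  have hm1 : (0 : ℝ) < m - 1 := by
    have : (2 : ℝ) ≤ m := Nat.ofNat_le_cast.2 hm
    linarith
  have hcoord (k : Fin 3 → ℕ) (hk : ∑ i, k i + 1 = m) :
      ∀ j, coord (∑ i, (k i / (m - 1) : ℝ) • P i) j = (k j / (m - 1) : ℝ) := by
    refine congrFun (coord_sum_smul (fun i => (k i / (m - 1) : ℝ)) ?_)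
    rw [← Finset.sum_div, div_eq_one_iff_eq hm1.ne', ← hk]
    push_cast
    ring
  have hmem (c : Bool) (k : Fin 3 → ℕ) (hk : ∑ i, k i + 1 = m) (hkS : up m k ∈ S.ups c) :
      ∑ i, (k i / (m - 1) : ℝ) • P i ∈ S.fractal c := by
    refine mem_fractal_of_proj_eq hkS (fun i => ?_) (coord_injective (funext fun i => ?_))
    · rw [hcoord k hk]
      positivity
    · rw [coord_proj_up hk, hcoord k hk]
      have : (m : ℝ) ≠ 0 := by linarith
      field_simp
      ring
  refine ⟨_, hmem c k hk hkW, _, hmem (!c) l hl hlY, ?_, ?_, fun i hi => ?_⟩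
  · rw [hcoord k hk, hkl.left, Nat.cast_zero, zero_div]
  · rw [hcoord l hl, hkl.right, Nat.cast_zero, zero_div]
  · rw [hcoord k hk, hcoord l hl, ← add_div, div_eq_one_iff_eq hm1.ne', ← hkl.add i hi]
    push_cast
    ring

/-- An upside down cell touches side `j` at most in the image of `P j`, a lattice point. Its mirror
image is then also a lattice point, hence a vertex of the cell containing `y`, and this forces a
forbidden corner. -/
theorem IsLabyrinth.not_mirrorPoints_proj_down (hS : S.IsLabyrinth) (hm : 2 ≤ m) {j : Fin 3}
    {k : Fin 3 → ℕ} (hk : ∑ i, k i + 2 = m) {x y : Plane} (hx : x ∈ S.fractal !c)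
    (hy : y ∈ S.fractal !c) : ¬MirrorPoints j ((down m k).proj x) y := by
  rintro ⟨hj, hyj, h⟩
  have hm0 : m ≠ 0 := by omega
  have hm' : (0 : ℝ) < m := by positivity
  have hxs := S.fractal_subset_simplex _ hx
  have hxj : coord x j = 1 := by
    rw [coord_proj_down hk, div_eq_zero_iff, or_iff_left hm'.ne'] at hj
    linarith [coord_le_one hxs j, (k j).cast_nonneg (α := ℝ)]
  obtain ⟨a, b, ha, hb, hab, hall, hN, hR⟩ := exists_others j
  have hsum : ∀ i, i ≠ j → (k i + 1 : ℝ) + m * coord y i = m := by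
    intro i hi
    have := h i hi
    rw [coord_proj_down hk, coord_eq_zero_of_coord_eq_one hxs hxj hi] at this
    field_simp at this
    linarith
  rcases mem_fractal_cases hm0 hy with ⟨l, hl, hlS, z, hz, rfl⟩ | ⟨l, hl, hlS, z, hz, rfl⟩
  · have hzs := S.fractal_subset_simplex _ hz
    rw [coord_proj_up hl, div_eq_zero_iff, or_iff_left hm'.ne'] at hyj
    have hzj : coord z j = 0 := by linarith [hzs j, (l j).cast_nonneg (α := ℝ)]
    have hint : ∀ i, i ≠ j → (k i + 1 : ℝ) + l i + coord z i = m := by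
      intro i hi
      have := hsum i hi
      rw [coord_proj_up hl] at this
      field_simp at this
      linarith
    -- By `hint` the coordinates of `z` at `a` and `b` are integers; they are non-negative with sum
    -- one, so one of them equals one.
    have hone : ∃ i, i ≠ j ∧ coord z i = 1 := by
      by_cases hka : k a + 1 + l a = m
      · refine ⟨b, hb, ?_⟩
        have : (k a : ℝ) + 1 + l a = m := by exact_mod_cast hka
        linarith [hint a ha, hR z]
      · refine ⟨a, ha, ?_⟩
        have h1 : (k a : ℝ) + 1 + l a ≤ m := by linarith [hint a ha, hzs a]
        have h2 : k a + 1 + l a ≤ m := by exact_mod_cast h1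
        have h3 : k a + 1 + l a + 1 ≤ m := by omega
        have h4 : (k a : ℝ) + 1 + l a + 1 ≤ m := by exact_mod_cast h3
        linarith [hint a ha, coord_le_one hzs a]
    obtain ⟨i, hi, hzi⟩ := hone
    exact hi (hS.corner_unique hm hz hx hzi hxj)
  · have hzs := S.fractal_subset_simplex _ hz
    rw [coord_proj_down hl, div_eq_zero_iff, or_iff_left hm'.ne'] at hyj
    have hzj : coord z j = 1 := by
      linarith [coord_le_one hzs j, (l j).cast_nonneg (α := ℝ)]
    exact hS.corner_disjoint hm hx hz hxj hzj

theorem IsLabyrinth.mirrorPoints_cases (hS : S.IsLabyrinth) (hm : 2 ≤ m) {j : Fin 3}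
    {x y : Plane} (hx : x ∈ S.fractal c) (hy : y ∈ S.fractal !c) (h : MirrorPoints j x y) :
    ∃ k l, MirrorIndices m j k l ∧ up m k ∈ S.ups c ∧ up m l ∈ S.ups (!c) ∧
      ∃ x' ∈ S.fractal c, ∃ y' ∈ S.fractal !c, MirrorPoints j x' y' ∧
        (up m k).proj x' = x ∧ (up m l).proj y' = y := by
  have hm0 : m ≠ 0 := by omega
  have hm' : (0 : ℝ) < m := by positivity
  rcases mem_fractal_cases hm0 hx with ⟨k, hk, hkS, x, hx', rfl⟩ | ⟨k, hk, hkS, x, hx', rfl⟩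
  swap
  · exact absurd h (hS.not_mirrorPoints_proj_down hm hk hx' hy)
  rcases mem_fractal_cases hm0 hy with ⟨l, hl, hlS, y, hy', rfl⟩ | ⟨l, hl, hlS, y, hy', rfl⟩
  swap
  · rw [Bool.not_not] at hy'
    refine absurd h.symm (hS.not_mirrorPoints_proj_down (c := !c) hm hl ?_ ?_)
    · rwa [Bool.not_not]
    · rwa [Bool.not_not]
  obtain ⟨hxj, hyj, hxy⟩ := h
  have hxs := S.fractal_subset_simplex _ hx'
  have hys := S.fractal_subset_simplex _ hy'
  rw [coord_proj_up hk, div_eq_zero_iff, or_iff_left hm'.ne'] at hxj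
  rw [coord_proj_up hl, div_eq_zero_iff, or_iff_left hm'.ne'] at hyj
  have hx0 : coord x j = 0 := by linarith [hxs j, (k j).cast_nonneg (α := ℝ)]
  have hy0 : coord y j = 0 := by linarith [hys j, (l j).cast_nonneg (α := ℝ)]
  have hk0 : k j = 0 := by
    rw [hx0, add_zero, Nat.cast_eq_zero] at hxj
    exact hxj
  have hl0 : l j = 0 := by
    rw [hy0, add_zero, Nat.cast_eq_zero] at hyj
    exact hyj
  have hsum : ∀ i, i ≠ j → (k i + l i : ℝ) + (coord x i + coord y i) = m := by
    intro i hi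
    have := hxy i hi
    rw [coord_proj_up hk, coord_proj_up hl] at this
    field_simp at this
    linarith
  obtain ⟨a, b, ha, hb, hab, hall, hN, hR⟩ := exists_others j
  have hkN := hN k
  have hlN := hN l
  -- Otherwise `coord x i + coord y i ≥ 2`, and both points would be the corner `P i`.
  have hnot : ∀ i, i ≠ j → ¬(k i + l i + 2 ≤ m) := by
    intro i hi hle
    have : (k i + l i + 2 : ℝ) ≤ m := by exact_mod_cast hle
    have hxi : coord x i = 1 := by linarith [hsum i hi, coord_le_one hxs i, coord_le_one hys i]
    have hyi : coord y i = 1 := by linarith [hsum i hi, coord_le_one hxs i, coord_le_one hys i]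
    exact hS.corner_disjoint hm hx' hy' hxi hyi
  -- The two sums `k i + l i` are at least `m - 1` and add up to `2 * (m - 1)`.
  have hkl : ∀ i, i ≠ j → k i + l i + 1 = m := by
    have h1 := hnot a ha
    have h2 := hnot b hb
    intro i hi
    rcases hall i with rfl | rfl | rfl
    · exact absurd rfl hi
    all_goals omega
  refine ⟨k, l, ⟨hk, hl, hk0, hl0, hkl⟩, hkS, hlS, x, hx', y, hy', ⟨hx0, hy0, fun i hi => ?_⟩, rfl, rfl⟩
  have : (k i + l i + 1 : ℝ) = m := by exact_mod_cast hkl i hi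
  linarith [hsum i hi]

/-- Matching exits are unique, so `x` and `x'` lie in the same cell, and their preimages there again
belong to mirror pairs. Iteration bounds their distance by `D / m ^ n` for every `n`. -/
theorem IsLabyrinth.mirrorPoints_unique (hS : S.IsLabyrinth) (hm : 2 ≤ m) {j : Fin 3}
    {x y x' y' : Plane} (hx : x ∈ S.fractal c) (hy : y ∈ S.fractal !c) (h : MirrorPoints j x y)
    (hx' : x' ∈ S.fractal c) (hy' : y' ∈ S.fractal !c) (h' : MirrorPoints j x' y') : x = x' := by
  obtain ⟨D, hD⟩ := Metric.isBounded_iff.1 isCompact_simplex.isBounded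
  have key (n : ℕ) : ∀ x ∈ S.fractal c, ∀ y ∈ S.fractal !c, MirrorPoints j x y →
      ∀ x' ∈ S.fractal c, ∀ y' ∈ S.fractal !c, MirrorPoints j x' y' →
        dist x x' ≤ D * (1 / m : ℝ) ^ n := by
    induction n with
    | zero =>
      intro x hx _ _ _ x' hx' _ _ _
      simpa using hD (S.fractal_subset_simplex c hx) (S.fractal_subset_simplex c hx')
    | succ n ih =>
      intro x hx y hy h x' hx' y' hy' h'
      obtain ⟨k, l, hkl, hk, hl, z, hz, w, hw, hzw, rfl, rfl⟩ := hS.mirrorPoints_cases hm hx hy h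
      obtain ⟨k', l', hkl', hk', hl', z', hz', w', hw', hzw', rfl, rfl⟩ :=
        hS.mirrorPoints_cases hm hx' hy' h'
      obtain ⟨_, _, -, -, -, huniq⟩ := hS.exists_mirrorIndices c j
      rw [(huniq k l hkl hk hl).1, ← (huniq k' l' hkl' hk' hl').1,
        dist_proj (Or.inl (S.ups_subset c hk')), pow_succ', mul_left_comm]
      exact mul_le_mul_of_nonneg_left (ih z hz w hw hzw z' hz' w' hw' hzw') (by positivity)
  have hm1 : (1 / m : ℝ) < 1 := by
    rw [one_div]
    exact inv_lt_one_of_one_lt₀ (by exact_mod_cast hm)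
  have ht := (tendsto_pow_atTop_nhds_zero_of_lt_one (by positivity) hm1).const_mul D
  rw [mul_zero] at ht
  exact dist_le_zero.1 (ge_of_tendsto' ht fun n => key n x hx y hy h x' hx' y' hy' h')

end PatternsSystem
end TriLabyrinth

/-! ### How the pieces meet -/

namespace TriLabyrinth
namespace PatternsSystem

variable {m : ℕ} {S : PatternsSystem m} {c : Bool}

/-- Where `k i < l i`, a common point forces `x` to be the corner `P i`; where `l j < k j`, it
forces `y` to be `P j`. Both belong to one fractal, so `i = j`, which is absurd. -/
theorem IsLabyrinth.proj_up_ne_proj_up (hS : S.IsLabyrinth) (hm : 2 ≤ m) {k l : Fin 3 → ℕ}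
    (hk : ∑ i, k i + 1 = m) (hl : ∑ i, l i + 1 = m) (hkl : k ≠ l) {x y : Plane}
    (hx : x ∈ S.fractal c) (hy : y ∈ S.fractal c) : (up m k).proj x ≠ (up m l).proj y := by
  intro h
  have hxs := S.fractal_subset_simplex _ hx
  have hys := S.fractal_subset_simplex _ hy
  have hm' : (m : ℝ) ≠ 0 := by
    rw [Nat.cast_ne_zero]
    omega
  have hc (i : Fin 3) : (k i + coord x i : ℝ) = l i + coord y i := by
    rw [← div_left_inj' hm', ← coord_proj_up hk, ← coord_proj_up hl, h]
  obtain ⟨i, hi⟩ := exists_lt_of_sum_eq (show ∑ i, k i = ∑ i, l i by omega) hkl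
  obtain ⟨j, hj⟩ := exists_lt_of_sum_eq (show ∑ i, l i = ∑ i, k i by omega) hkl.symm
  have hi' : (k i + 1 : ℝ) ≤ l i := by exact_mod_cast hi
  have hj' : (l j + 1 : ℝ) ≤ k j := by exact_mod_cast hj
  have hij : i = j := hS.corner_unique hm hx hy
    (by linarith [hc i, coord_le_one hxs i, hys i]) (by linarith [hc j, coord_le_one hys j, hxs j])
  rw [hij] at hi
  exact hi.not_gt hj

theorem IsLabyrinth.proj_down_ne_proj_down (hS : S.IsLabyrinth) (hm : 2 ≤ m) {k l : Fin 3 → ℕ}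
    (hk : ∑ i, k i + 2 = m) (hl : ∑ i, l i + 2 = m) (hkl : k ≠ l) {x y : Plane}
    (hx : x ∈ S.fractal c) (hy : y ∈ S.fractal c) : (down m k).proj x ≠ (down m l).proj y := by
  intro h
  have hxs := S.fractal_subset_simplex _ hx
  have hys := S.fractal_subset_simplex _ hy
  have hm' : (m : ℝ) ≠ 0 := by
    rw [Nat.cast_ne_zero]
    omega
  have hc (i : Fin 3) : (k i + 1 - coord x i : ℝ) = l i + 1 - coord y i := by
    rw [← div_left_inj' hm', ← coord_proj_down hk, ← coord_proj_down hl, h]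
  obtain ⟨i, hi⟩ := exists_lt_of_sum_eq (show ∑ i, k i = ∑ i, l i by omega) hkl
  obtain ⟨j, hj⟩ := exists_lt_of_sum_eq (show ∑ i, l i = ∑ i, k i by omega) hkl.symm
  have hi' : (k i + 1 : ℝ) ≤ l i := by exact_mod_cast hi
  have hj' : (l j + 1 : ℝ) ≤ k j := by exact_mod_cast hj
  have hij : i = j := hS.corner_unique hm hy hx
    (by linarith [hc i, coord_le_one hys i, hxs i]) (by linarith [hc j, coord_le_one hxs j, hys j])
  rw [hij] at hi
  exact hi.not_gt hj

/-- Since the upside down cell is point-reflected, its points on the common side are read in the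
opposite direction; this is the origin of the mirror condition. -/
theorem proj_up_eq_proj_down_iff {k l : Fin 3 → ℕ} (hk : ∑ i, k i + 1 = m)
    (hl : ∑ i, l i + 2 = m) {j : Fin 3} (hj : k j = l j + 1) (hkl : ∀ i, i ≠ j → k i = l i)
    {x y : Plane} (hx : x ∈ simplex) (hy : y ∈ simplex) :
    (up m k).proj x = (down m l).proj y ↔ MirrorPoints j x y := by
  have hm' : (m : ℝ) ≠ 0 := by
    rw [Nat.cast_ne_zero]
    omega
  have hj' : (k j : ℝ) = l j + 1 := by exact_mod_cast hj
  constructor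
  · intro h
    have hc (i : Fin 3) : (k i + coord x i : ℝ) = l i + 1 - coord y i := by
      rw [← div_left_inj' hm', ← coord_proj_up hk, ← coord_proj_down hl, h]
    refine ⟨by linarith [hc j, hx j, hy j], by linarith [hc j, hx j, hy j], fun i hi => ?_⟩
    have := hc i
    rw [hkl i hi] at this
    linarith
  · rintro ⟨hxj, hyj, h⟩
    refine coord_injective (funext fun i => ?_)
    rw [coord_proj_up hk, coord_proj_down hl]
    congr 1
    by_cases hi : i = j
    · rw [hi]
      linarith
    · rw [hkl i hi]
      linarith [h i hi]

/-- If `k i < l i`, then `x` and `y` are both the corner `P i`, which is forbidden. So `l ≤ k`, and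
as the sums differ by one, exactly one entry differs. -/
theorem IsLabyrinth.exists_side_of_proj_up_eq_proj_down (hS : S.IsLabyrinth) (hm : 2 ≤ m)
    {k l : Fin 3 → ℕ} (hk : ∑ i, k i + 1 = m) (hl : ∑ i, l i + 2 = m) {x y : Plane}
    (hx : x ∈ S.fractal c) (hy : y ∈ S.fractal !c) (h : (up m k).proj x = (down m l).proj y) :
    ∃ j, k j = l j + 1 ∧ ∀ i, i ≠ j → k i = l i := by
  have hxs := S.fractal_subset_simplex _ hx
  have hys := S.fractal_subset_simplex _ hy
  have hm' : (m : ℝ) ≠ 0 := by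
    rw [Nat.cast_ne_zero]
    omega
  have hc (i : Fin 3) : (k i + coord x i : ℝ) = l i + 1 - coord y i := by
    rw [← div_left_inj' hm', ← coord_proj_up hk, ← coord_proj_down hl, h]
  have hle (i : Fin 3) : l i ≤ k i := by
    by_contra! hlt
    have hlt' : (k i + 1 : ℝ) ≤ l i := by exact_mod_cast hlt
    exact hS.corner_disjoint hm hx hy (i := i)
      (by linarith [hc i, coord_le_one hxs i, coord_le_one hys i])
      (by linarith [hc i, coord_le_one hxs i, coord_le_one hys i])
  obtain ⟨j, hj⟩ : ∃ j, l j < k j := by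
    by_contra! hge
    have := Finset.sum_le_sum fun i (_ : i ∈ Finset.univ) => hge i
    omega
  obtain ⟨a, b, ha, hb, hab, hall, hN, -⟩ := exists_others j
  have hkN := hN k
  have hlN := hN l
  have hla := hle a
  have hlb := hle b
  refine ⟨j, by omega, fun i hi => ?_⟩
  rcases hall i with rfl | rfl | rfl
  · exact absurd rfl hi
  all_goals omega

/-- The pieces of the fractal of colour `c`. -/
noncomputable def piece (S : PatternsSystem m) (c : Bool) (A : Triangle) : Set Plane :=
  A.proj '' S.fractal (S.refinement c A)

theorem piece_of_mem_ups {A : Triangle} (hA : A ∈ S.ups c) :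
    S.piece c A = A.proj '' S.fractal c := by
  rw [piece, S.refinement_of_mem_ups hA]

theorem piece_of_mem_downs {A : Triangle} (hA : A ∈ S.downs c) :
    S.piece c A = A.proj '' S.fractal !c := by
  rw [piece, S.refinement_of_mem_downs hA]

theorem IsLabyrinth.exists_neighbours_of_mem_ups_of_mem_downs (hS : S.IsLabyrinth) (hm : 2 ≤ m)
    {A B : Triangle} (hA : A ∈ S.ups c) (hB : B ∈ S.downs c)
    (h : (S.piece c A ∩ S.piece c B).Nonempty) : ∃ j, Neighbours m j A B := by
  rw [piece_of_mem_ups hA, piece_of_mem_downs hB] at h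
  obtain ⟨k, hk, rfl⟩ := S.ups_subset c hA
  obtain ⟨l, hl, rfl⟩ := S.downs_subset c hB
  obtain ⟨_, ⟨x, hx, rfl⟩, y, hy, hxy⟩ := h
  obtain ⟨j, hj, hkl⟩ := hS.exists_side_of_proj_up_eq_proj_down hm hk hl hx hy hxy.symm
  exact ⟨j, k, l, ⟨hk, rfl⟩, ⟨hl, rfl⟩, hj, hkl⟩

theorem IsLabyrinth.subsingleton_of_mem_ups_of_mem_downs (hS : S.IsLabyrinth) (hm : 2 ≤ m)
    {A B : Triangle} (hA : A ∈ S.ups c) (hB : B ∈ S.downs c) :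
    (S.piece c A ∩ S.piece c B).Subsingleton := by
  rw [piece_of_mem_ups hA, piece_of_mem_downs hB]
  obtain ⟨k, hk, rfl⟩ := S.ups_subset c hA
  obtain ⟨l, hl, rfl⟩ := S.downs_subset c hB
  rintro _ ⟨⟨x, hx, rfl⟩, y, hy, hxy⟩ _ ⟨⟨x', hx', rfl⟩, y', hy', hxy'⟩
  obtain ⟨j, hj, hkl⟩ := hS.exists_side_of_proj_up_eq_proj_down hm hk hl hx hy hxy.symm
  have hs := S.fractal_subset_simplex
  rw [hS.mirrorPoints_unique hm hx hy
    ((proj_up_eq_proj_down_iff hk hl hj hkl (hs _ hx) (hs _ hy)).1 hxy.symm) hx' hy'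
    ((proj_up_eq_proj_down_iff hk hl hj hkl (hs _ hx') (hs _ hy')).1 hxy'.symm)]

theorem IsLabyrinth.disjoint_of_mem_ups (hS : S.IsLabyrinth) (hm : 2 ≤ m) {A B : Triangle}
    (hA : A ∈ S.ups c) (hB : B ∈ S.ups c) (hAB : A ≠ B) :
    S.piece c A ∩ S.piece c B = ∅ := by
  rw [piece_of_mem_ups hA, piece_of_mem_ups hB, ← disjoint_iff_inter_eq_empty, Set.disjoint_left]
  obtain ⟨k, hk, rfl⟩ := S.ups_subset c hA
  obtain ⟨l, hl, rfl⟩ := S.ups_subset c hB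
  rintro _ ⟨x, hx, rfl⟩ ⟨y, hy, hxy⟩
  exact hS.proj_up_ne_proj_up hm hk hl (fun h => hAB (congrArg _ h)) hx hy hxy.symm

theorem IsLabyrinth.disjoint_of_mem_downs (hS : S.IsLabyrinth) (hm : 2 ≤ m) {A B : Triangle}
    (hA : A ∈ S.downs c) (hB : B ∈ S.downs c) (hAB : A ≠ B) :
    S.piece c A ∩ S.piece c B = ∅ := by
  rw [piece_of_mem_downs hA, piece_of_mem_downs hB, ← disjoint_iff_inter_eq_empty,
    Set.disjoint_left]
  obtain ⟨k, hk, rfl⟩ := S.downs_subset c hA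
  obtain ⟨l, hl, rfl⟩ := S.downs_subset c hB
  rintro _ ⟨x, hx, rfl⟩ ⟨y, hy, hxy⟩
  exact hS.proj_down_ne_proj_down hm hk hl (fun h => hAB (congrArg _ h)) hx hy hxy.symm

theorem IsLabyrinth.nonempty_of_neighbours (hS : S.IsLabyrinth) (hm : 2 ≤ m) {A B : Triangle}
    (hA : A ∈ S.cells c) (hB : B ∈ S.cells c) {j : Fin 3} (h : Neighbours m j A B) :
    (S.piece c A ∩ S.piece c B).Nonempty := by
  obtain ⟨k, l, ⟨hk, rfl⟩, ⟨hl, rfl⟩, hj, hkl⟩ := h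
  have hdisj := disjoint_upTriangles_downTriangles m
  have hA : up m k ∈ S.ups c := hA.resolve_right fun h =>
    hdisj.notMem_of_mem_left ⟨k, hk, rfl⟩ (S.downs_subset c h)
  have hB : down m l ∈ S.downs c := hB.resolve_left fun h =>
    hdisj.notMem_of_mem_right ⟨l, hl, rfl⟩ (S.ups_subset c h)
  obtain ⟨x, hx, y, hy, hxy⟩ := hS.exists_mirrorPoints hm c j
  have hs := S.fractal_subset_simplex
  rw [piece_of_mem_ups hA, piece_of_mem_downs hB]
  exact ⟨_, mem_image_of_mem _ hx, y, hy,
    ((proj_up_eq_proj_down_iff hk hl hj hkl (hs _ hx) (hs _ hy)).2 hxy).symm⟩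

theorem IsLabyrinth.isTree_triangleGraph_cells (hS : S.IsLabyrinth) :
    ∀ c, (triangleGraph m (S.cells c)).IsTree
  | true => hS.tree.1
  | false => hS.tree.2

theorem IsLabyrinth.treeLikeSystem (hS : S.IsLabyrinth) (hm : 2 ≤ m) :
    TreeLikeSystem (fun c => triangleGraph m (S.cells c)) (fun c (A : S.cells c) => A.1.proj)
      (fun c A => S.refinement c A) S.fractal (1 / m : ℝ) where
  pos := by positivity
  lt_one := by
    rw [one_div]
    exact inv_lt_one_of_one_lt₀ (by exact_mod_cast hm)
  dist_eq c A := dist_proj (S.cells_subset c A.2)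
  isCompact := isCompact_fractal
  nonempty c :=
    let ⟨x, hx, _⟩ := hS.exists_mirrorPoints hm c 0
    ⟨x, hx⟩
  eq_iUnion := fractal_eq_iUnion (by omega)
  isTree := hS.isTree_triangleGraph_cells
  inter_nonempty := by
    intro c A B h
    rw [triangleGraph, SimpleGraph.fromRel_adj] at h
    obtain ⟨-, ⟨j, h⟩ | ⟨j, h⟩⟩ := h
    · exact hS.nonempty_of_neighbours hm A.2 B.2 h
    · rw [inter_comm]
      exact hS.nonempty_of_neighbours hm B.2 A.2 h
  adj := by
    rintro c ⟨A, hA⟩ ⟨B, hB⟩ hAB h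
    rw [triangleGraph, SimpleGraph.fromRel_adj]
    have hAB' : A ≠ B := fun h => hAB (Subtype.ext h)
    change (S.piece c A ∩ S.piece c B).Nonempty at h
    refine ⟨hAB, ?_⟩
    rcases hA with hA | hA <;> rcases hB with hB | hB
    · exact absurd (hS.disjoint_of_mem_ups hm hA hB hAB') h.ne_empty
    · exact Or.inl (hS.exists_neighbours_of_mem_ups_of_mem_downs hm hA hB h)
    · rw [inter_comm] at h
      exact Or.inr (hS.exists_neighbours_of_mem_ups_of_mem_downs hm hB hA h)
    · exact absurd (hS.disjoint_of_mem_downs hm hA hB hAB') h.ne_empty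
  inter_subsingleton := by
    rintro c ⟨A, hA⟩ ⟨B, hB⟩ hAB
    have hAB' : A ≠ B := fun h => hAB (Subtype.ext h)
    change (S.piece c A ∩ S.piece c B).Subsingleton
    rcases hA with hA | hA <;> rcases hB with hB | hB
    · rw [hS.disjoint_of_mem_ups hm hA hB hAB']
      exact subsingleton_empty
    · exact hS.subsingleton_of_mem_ups_of_mem_downs hm hA hB
    · rw [inter_comm]
      exact hS.subsingleton_of_mem_ups_of_mem_downs hm hB hA
    · rw [hS.disjoint_of_mem_downs hm hA hB hAB']
      exact subsingleton_empty

end PatternsSystem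
end TriLabyrinth

theorem theorem5p4 (m : ℕ) (hm : 2 ≤ m) (S : TriLabyrinth.PatternsSystem m)
    (hS : S.IsLabyrinth) :
    TriLabyrinth.IsDendrite S.whiteFractal ∧ TriLabyrinth.IsDendrite S.yellowFractal := by
  have h := hS.treeLikeSystem hm
  rw [S.whiteFractal_eq, S.yellowFractal_eq]
  exact ⟨h.isDendrite true, h.isDendrite false⟩
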